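/- Let $n$ be the space dimension and let $a,m\in C^2[0,\infty)$ be positive functions with $a(0)=m(0)=1$. Put $$A(t)=1+\int_0^t a(\tau)\,d\tau,\qquad \eta(t)=\frac{a(t)}{A(t)},\qquad \mu(t)=\frac{m(t)}{\eta(t)},\qquad \gamma(t)=\max\{a(t),m(t)\}.$$ Assume that $a\notin L^1[0,\infty)$ and that, for $k=1,2$, there are constants $C_k,C_k'>0$ such that for all $t\ge 0$ $$\frac{|a^{(k)}(t)|}{a(t)}\le C_k\,\eta(t)^k,\qquad |\mu^{(k)}(t)|\le C_k'\,\mu(t)\,\eta(t)^k .$$ Assume moreover that $\lim_{t\to\infty}\mu(t)=\infty$ (effective potential) and that $\eta/\mu\in L^1[0,\infty)$. Then there is a constant $C>0$, independent of the data and of the solution, such that for all $(u_0,u_1)\in H^1(\mathbb R^n)\times L^2(\mathbb R^n)$ every energy solution $u\in C([0,\infty),H^1(\mathbb R^n))\cap C^1([0,\infty),L^2(\mathbb R^n))$ (the equation being understood in the sense of distributions) of the Cauchy problem $$u_{tt}-a(t)^2\Delta u+m(t)^2u=0,\qquad u(0,\cdot)=u_0,\quad u_t(0,\cdot)=u_1,$$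 satisfies $$E(u)(t)\le C\,\gamma(t)\,E(u)(0)\qquad\text{for all } t\ge 0,$$ where $$E(u)(t)=\tfrac12\Big(\|u_t(t,\cdot)\|_{L^2}^2+a(t)^2\|\nabla u(t,\cdot)\|_{L^2}^2+m(t)\gamma(t)\|u(t,\cdot)\|_{L^2}^2\Big).$$ Consequently, $$\|u(t,\cdot)\|_{L^2}^2\le \frac{C}{m(t)}\,E(u)(0)\qquad\text{for all } t\ge 0$$ (after enlarging $C$ if necessary); in particular, for increasing $m$ the potential energy $\|u(t,\cdot)\|_{L^2}^2$ decays like $1/m(t)$. -/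

import Mathlib

open Set Filter MeasureTheory TemperedDistribution
open scoped ENNReal Topology SchwartzMap LineDeriv Laplacian

noncomputable section

namespace EffectivePotential

/-- `A(t) = 1 + ∫₀ᵗ a(τ) dτ`. -/
def bigA (a : ℝ → ℝ) (t : ℝ) : ℝ := 1 + ∫ τ in (0 : ℝ)..t, a τ

/-- `η(t) = a(t) / A(t)`. -/
def eta (a : ℝ → ℝ) (t : ℝ) : ℝ := a t / bigA a t

/-- `γ(t) = max {a(t), m(t)}`. -/
def gam (a m : ℝ → ℝ) (t : ℝ) : ℝ := max (a t) (m t)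

/-- The standing hypotheses on the speed of propagation `a` on `[0, ∞)`: it is `C²`, positive,
not integrable, normalised by `a(0) = 1`, and `|a⁽ᵏ⁾| / a ≲ ηᵏ` for `k = 1, 2`. -/
structure SpeedHyp (a : ℝ → ℝ) : Prop where
  contDiffOn : ContDiffOn ℝ 2 a (Ici 0)
  pos : ∀ t, 0 ≤ t → 0 < a t
  not_integrable : ¬ IntegrableOn a (Ici 0)
  init : a 0 = 1
  shape : ∀ k ∈ ({1, 2} : Set ℕ), ∃ C : ℝ, 0 < C ∧ ∀ t, 0 ≤ t →
    |iteratedDerivWithin k a (Ici 0) t| / a t ≤ C * eta a t ^ k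

/-- The standing hypotheses on the mass `m` on `[0, ∞)`: it is `C²`, positive, of the form
`m = μ η`, normalised by `m(0) = 1`, and `|μ⁽ᵏ⁾| ≲ μ ηᵏ` for `k = 1, 2`. -/
structure MassHyp (a m μ : ℝ → ℝ) : Prop where
  contDiffOn : ContDiffOn ℝ 2 m (Ici 0)
  form : ∀ t, 0 ≤ t → m t = μ t * eta a t
  pos : ∀ t, 0 ≤ t → 0 < m t
  init : m 0 = 1
  shape : ∀ k ∈ ({1, 2} : Set ℕ), ∃ C : ℝ, 0 < C ∧ ∀ t, 0 ≤ t →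
    |iteratedDerivWithin k μ (Ici 0) t| ≤ C * μ t * eta a t ^ k

/-- The complex Hilbert space `L²(ℝⁿ)`. -/
abbrev L2 (n : ℕ) : Type := Lp ℂ 2 (volume : Measure (EuclideanSpace ℝ (Fin n)))

/-- `f ∈ L²(ℝⁿ)` belongs to the Sobolev space `H¹(ℝⁿ)`. -/
def MemH1 {n : ℕ} (f : L2 n) : Prop :=
  MemSobolev 1 2 (f : 𝓢'(EuclideanSpace ℝ (Fin n), ℂ))

/-- `g ∈ L²` is the weak (distributional) partial derivative `∂_j f` of `f ∈ L²`. -/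
def IsWeakPartial {n : ℕ} (j : Fin n) (f g : L2 n) : Prop :=
  ∂_{EuclideanSpace.single j (1 : ℝ)} (f : 𝓢'(EuclideanSpace ℝ (Fin n), ℂ)) =
    (g : 𝓢'(EuclideanSpace ℝ (Fin n), ℂ))

open Classical in
/-- The weak partial derivative `∂_j f` as an element of `L²`; it is used only for `f ∈ H¹`,
where it exists (`isWeakPartial_weakPartial`), and is `0` by convention if it does not exist. -/
def weakPartial {n : ℕ} (j : Fin n) (f : L2 n) : L2 n :=
  if h : ∃ g : L2 n, IsWeakPartial j f g then h.choose else 0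

theorem isWeakPartial_weakPartial {n : ℕ} (j : Fin n) {f : L2 n} (hf : MemH1 f) :
    IsWeakPartial j f (weakPartial j f) := by
  have h : ∃ g : L2 n, IsWeakPartial j f g := by
    have h1 := MemSobolev.lineDerivOp (m := EuclideanSpace.single j (1 : ℝ)) hf
    rw [sub_self] at h1
    exact memSobolev_zero_iff.mp h1
  unfold weakPartial
  rw [dif_pos h]
  exact h.choose_spec

/-- The time derivative `u_t(t) ∈ L²`, one-sided at `t = 0`. -/
def timeDeriv {n : ℕ} (u : ℝ → L2 n) (t : ℝ) : L2 n := derivWithin u (Ici 0) t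

/-- `u ∈ C([0,∞), H¹(ℝⁿ)) ∩ C¹([0,∞), L²(ℝⁿ))` is an energy solution of
`u_tt - a(t)² Δu + m(t)² u = 0` on `(0,∞) × ℝⁿ`, `u(0) = u₀`, `u_t(0) = u₁`.

Continuity in `H¹` is continuity in `L²` of `u` (contained in `contDiffOn`) and of all weak
partial derivatives of `u`. As `u_t` is only `L²`-valued, the equation is understood in the sense
of (tempered) distributions in `x`: for every test function `φ`, the function
`t ↦ ⟨u_t(t), φ⟩` has derivative `⟨a(t)² Δu(t) - m(t)² u(t), φ⟩`. -/
structure IsEnergySolution {n : ℕ} (a m : ℝ → ℝ) (u₀ u₁ : L2 n) (u : ℝ → L2 n) : Prop where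
  memH1 : ∀ t, 0 ≤ t → MemH1 (u t)
  continuousOn_partial : ∀ j, ContinuousOn (fun t => weakPartial j (u t)) (Ici 0)
  contDiffOn : ContDiffOn ℝ 1 u (Ici 0)
  init : u 0 = u₀
  init_deriv : timeDeriv u 0 = u₁
  equation : ∀ φ : 𝓢(EuclideanSpace ℝ (Fin n), ℂ), ∀ t, 0 < t →
    HasDerivAt (fun s => (timeDeriv u s : 𝓢'(EuclideanSpace ℝ (Fin n), ℂ)) φ)
      (((a t : ℂ) ^ 2 • Δ (u t : 𝓢'(EuclideanSpace ℝ (Fin n), ℂ))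
        - (m t : ℂ) ^ 2 • (u t : 𝓢'(EuclideanSpace ℝ (Fin n), ℂ))) φ) t

/-- `E(u)(t) = ½ (‖u_t(t)‖² + a(t)² ‖∇u(t)‖² + m(t) γ(t) ‖u(t)‖²)` with `L²` norms. -/
def energy {n : ℕ} (a m : ℝ → ℝ) (u : ℝ → L2 n) (t : ℝ) : ℝ :=
  1 / 2 * (‖timeDeriv u t‖ ^ 2 + a t ^ 2 * ∑ j, ‖weakPartial j (u t)‖ ^ 2
    + m t * gam a m t * ‖u t‖ ^ 2)

end EffectivePotential

end

open EffectivePotential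

/-! At frequency `ξ` the equation is the oscillator `w'' + Λ w = 0` with `Λ = 4π²|ξ|² a² + m²`. In
the Liouville–Green variables `p = Λ^(-1/4) (w' + Λ'/(4Λ) w)` and `q = Λ^(1/4) w` it is a rotation
with speed `√Λ`, up to an error of size `η²/√Λ` (`hasDerivAt_wkbEnergy`). Since `√Λ ≥ m` and `η²/m =
η/μ` is integrable, Grönwall's inequality bounds `|p|² + |q|²` uniformly in time and frequency. As
`μ` is bounded below, `η ≲ m`, so the correction `Λ'/(4Λ) w` is harmless and `|w'|² + Λ|w|²` grows
at most like `√Λ(t)/√Λ(0) ≤ γ(t)` (`oscillator_energy_le`). The mass term gains more: dividing by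
`√Λ ≥ m` shows that `m|w|²` stays bounded, which is what the weight `mγ` requires.

A solution is only an `L²`-valued curve, so no differential equation is available at a single `ξ`.
Instead, for a fixed final time `T`, frequency space is cut into countably many thin bands of width
`δ` in `4π²|ξ|²`. On a band the symbol is frozen at its lower end `r`, and the restricted solution
is one Hilbert-space-valued oscillator with a perturbation of norm at most `a²δ‖w‖`
(`IsEnergySolution.hasDerivAt_cutoff`). The width depends on `T` and makes the accumulated
perturbation cost at most a factor `e`; the resulting constant depends on neither the band nor `T`,
so the estimates add up (`exists_energy_le`). -/

noncomputable section

namespace EffectivePotential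

/-! ### Symbol estimates for the coefficients -/

section Scalar

/-- A primitive of a function that is continuous on `[0, ∞)`. -/
theorem exists_primitive_of_continuousOn_Ici {F : Type*} [NormedAddCommGroup F] [NormedSpace ℝ F]
    [CompleteSpace F] {f : ℝ → F} (hf : ContinuousOn f (Ici 0)) :
    ∃ P : ℝ → F, (∀ t, 0 ≤ t → P t = ∫ τ in (0 : ℝ)..t, f τ) ∧
      ∀ t, 0 ≤ t → HasDerivAt P (f t) t := by
  -- Extending `f` by the constant `f 0` to the left makes the derivative of the primitive two-sided
  -- even at `0`.
  have hc : Continuous (fun s => f (max 0 s)) :=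
    hf.comp_continuous (by fun_prop) (fun s => le_max_left 0 s)
  refine ⟨fun t => ∫ τ in (0 : ℝ)..t, f (max 0 τ), fun t ht => ?_, fun t ht => ?_⟩
  · refine intervalIntegral.integral_congr fun s hs => ?_
    rw [uIcc_of_le ht] at hs
    simp [max_eq_right hs.1]
  · have h := (hc.integral_hasStrictDerivAt 0 t).hasDerivAt
    simpa [max_eq_right ht] using h

theorem hasDerivAt_iteratedDerivWithin {f : ℝ → ℝ} (hf : ContDiffOn ℝ 2 f (Ici 0)) :
    ContinuousOn (iteratedDerivWithin 1 f (Ici 0)) (Ici 0) ∧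
    (∀ t, 0 < t → HasDerivAt f (iteratedDerivWithin 1 f (Ici 0) t) t) ∧
    ∀ t, 0 < t → HasDerivAt (iteratedDerivWithin 1 f (Ici 0))
      (iteratedDerivWithin 2 f (Ici 0) t) t := by
  have hu : UniqueDiffOn ℝ (Ici (0 : ℝ)) := uniqueDiffOn_Ici 0
  have h1 : iteratedDerivWithin 1 f (Ici 0) = derivWithin f (Ici 0) := by
    funext t; simp [iteratedDerivWithin_one]
  have h2 : ∀ t, 0 < t → iteratedDerivWithin 2 f (Ici 0) t =
      derivWithin (iteratedDerivWithin 1 f (Ici 0)) (Ici 0) t := fun t ht => by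
    rw [← iteratedDerivWithin_succ]
  have hd : ContDiffOn ℝ 1 (derivWithin f (Ici 0)) (Ici 0) :=
    hf.derivWithin hu (by norm_num)
  refine ⟨?_, fun t ht => ?_, fun t ht => ?_⟩
  · rw [h1]; exact hd.continuousOn
  · rw [h1]
    exact ((hf.differentiableOn (by norm_num) t ht.le).hasDerivWithinAt).hasDerivAt
      (Ici_mem_nhds ht)
  · rw [h2 t ht, h1]
    exact ((hd.differentiableOn (by norm_num) t ht.le).hasDerivWithinAt).hasDerivAt
      (Ici_mem_nhds ht)

variable {a m μ : ℝ → ℝ}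

theorem SpeedHyp.bigA_pos (ha : SpeedHyp a) {t : ℝ} (ht : 0 ≤ t) : 0 < bigA a t := by
  have : 0 ≤ ∫ τ in (0 : ℝ)..t, a τ :=
    intervalIntegral.integral_nonneg ht fun s hs => (ha.pos s hs.1).le
  unfold bigA; linarith

theorem SpeedHyp.eta_pos (ha : SpeedHyp a) {t : ℝ} (ht : 0 ≤ t) : 0 < eta a t :=
  div_pos (ha.pos t ht) (ha.bigA_pos ht)

theorem SpeedHyp.hasDerivWithinAt_bigA (ha : SpeedHyp a) {t : ℝ} (ht : 0 ≤ t) :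
    HasDerivWithinAt (bigA a) (a t) (Ici 0) t := by
  obtain ⟨F, hF, hF'⟩ := exists_primitive_of_continuousOn_Ici ha.contDiffOn.continuousOn
  have h := ((hF' t ht).const_add 1).hasDerivWithinAt (s := Ici 0)
  exact h.congr (fun s hs => by simp [bigA, hF s hs]) (by simp [bigA, hF t ht])

theorem SpeedHyp.contDiffOn_bigA (ha : SpeedHyp a) : ContDiffOn ℝ 2 (bigA a) (Ici 0) := by
  have hu : UniqueDiffOn ℝ (Ici (0 : ℝ)) := uniqueDiffOn_Ici 0
  have : (2 : WithTop ℕ∞) = 1 + 1 := by norm_num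
  rw [this, contDiffOn_succ_iff_derivWithin hu]
  refine ⟨fun t ht => (ha.hasDerivWithinAt_bigA ht).differentiableWithinAt, by simp, ?_⟩
  refine (ha.contDiffOn.of_le (by norm_num)).congr fun t ht => ?_
  exact (ha.hasDerivWithinAt_bigA ht).derivWithin (hu t ht)

theorem SpeedHyp.contDiffOn_eta (ha : SpeedHyp a) : ContDiffOn ℝ 2 (eta a) (Ici 0) :=
  ha.contDiffOn.div ha.contDiffOn_bigA fun _ ht => (ha.bigA_pos ht).ne'

theorem MassHyp.mu_pos (ha : SpeedHyp a) (hm : MassHyp a m μ) {t : ℝ} (ht : 0 ≤ t) :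
    0 < μ t := by
  have h := hm.pos t ht
  rw [hm.form t ht] at h
  exact pos_of_mul_pos_left h (ha.eta_pos ht).le

theorem MassHyp.contDiffOn_mu (ha : SpeedHyp a) (hm : MassHyp a m μ) :
    ContDiffOn ℝ 2 μ (Ici 0) := by
  refine (hm.contDiffOn.div ha.contDiffOn_eta fun _ ht => (ha.eta_pos ht).ne').congr ?_
  intro t ht
  rw [Pi.div_apply, hm.form t ht, mul_div_cancel_right₀ _ (ha.eta_pos ht).ne']

/-- `f` has on `(0, ∞)` two derivatives `f₁`, `f₂`, with `f₁` continuous on `[0, ∞)`, and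
`|f₁| ≤ C η |f|`, `|f₂| ≤ C η² |f|`. -/
structure SymbolBound (η f f₁ f₂ : ℝ → ℝ) (C : ℝ) : Prop where
  continuousOn : ContinuousOn f (Ici 0)
  continuousOn_deriv : ContinuousOn f₁ (Ici 0)
  hasDerivAt : ∀ t, 0 < t → HasDerivAt f (f₁ t) t
  hasDerivAt_deriv : ∀ t, 0 < t → HasDerivAt f₁ (f₂ t) t
  bound_deriv : ∀ t, 0 ≤ t → |f₁ t| ≤ C * η t * f t
  bound_deriv_two : ∀ t, 0 ≤ t → |f₂ t| ≤ C * η t ^ 2 * f t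

theorem SymbolBound.mono {η f f₁ f₂ : ℝ → ℝ} {C D : ℝ} (h : SymbolBound η f f₁ f₂ C)
    (hη : ∀ t, 0 ≤ t → 0 ≤ η t) (hf : ∀ t, 0 ≤ t → 0 ≤ f t) (hCD : C ≤ D) :
    SymbolBound η f f₁ f₂ D where
  continuousOn := h.continuousOn
  continuousOn_deriv := h.continuousOn_deriv
  hasDerivAt := h.hasDerivAt
  hasDerivAt_deriv := h.hasDerivAt_deriv
  bound_deriv t ht := (h.bound_deriv t ht).trans <| by
    have := hη t ht; have := hf t ht; gcongr
  bound_deriv_two t ht := (h.bound_deriv_two t ht).trans <| by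
    have := hη t ht; have := hf t ht; gcongr

theorem SymbolBound.mul {η f f₁ f₂ g g₁ g₂ : ℝ → ℝ} {C D : ℝ} (hC : 0 ≤ C) (hD : 0 ≤ D)
    (hf : SymbolBound η f f₁ f₂ C) (hg : SymbolBound η g g₁ g₂ D)
    (hη : ∀ t, 0 ≤ t → 0 ≤ η t) (hf0 : ∀ t, 0 ≤ t → 0 ≤ f t) (hg0 : ∀ t, 0 ≤ t → 0 ≤ g t) :
    SymbolBound η (fun t => f t * g t) (fun t => f₁ t * g t + f t * g₁ t)
      (fun t => f₂ t * g t + f₁ t * g₁ t + (f₁ t * g₁ t + f t * g₂ t))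
      (C + D + 2 * C * D) where
  continuousOn := hf.continuousOn.mul hg.continuousOn
  continuousOn_deriv := (hf.continuousOn_deriv.mul hg.continuousOn).add
    (hf.continuousOn.mul hg.continuousOn_deriv)
  hasDerivAt t ht := (hf.hasDerivAt t ht).mul (hg.hasDerivAt t ht)
  hasDerivAt_deriv t ht := ((hf.hasDerivAt_deriv t ht).mul (hg.hasDerivAt t ht)).add
    ((hf.hasDerivAt t ht).mul (hg.hasDerivAt_deriv t ht))
  bound_deriv t ht := by
    have h1 := hf.bound_deriv t ht
    have h2 := hg.bound_deriv t ht
    have e := hη t ht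
    have ef := hf0 t ht
    have eg := hg0 t ht
    calc |f₁ t * g t + f t * g₁ t| ≤ |f₁ t| * g t + f t * |g₁ t| := by
          refine (abs_add_le _ _).trans (le_of_eq ?_)
          rw [abs_mul, abs_mul, abs_of_nonneg ef, abs_of_nonneg eg]
      _ ≤ (C * η t * f t) * g t + f t * (D * η t * g t) := by gcongr
      _ = (C + D) * η t * (f t * g t) := by ring
      _ ≤ (C + D + 2 * C * D) * η t * (f t * g t) := by
          have : C + D ≤ C + D + 2 * C * D := by nlinarith [mul_nonneg hC hD]
          gcongr
  bound_deriv_two t ht := by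
    have h1 := hf.bound_deriv t ht
    have h2 := hg.bound_deriv t ht
    have h3 := hf.bound_deriv_two t ht
    have h4 := hg.bound_deriv_two t ht
    have e := hη t ht
    have ef := hf0 t ht
    have eg := hg0 t ht
    calc |f₂ t * g t + f₁ t * g₁ t + (f₁ t * g₁ t + f t * g₂ t)|
        ≤ |f₂ t| * g t + |f₁ t| * |g₁ t| + (|f₁ t| * |g₁ t| + f t * |g₂ t|) := by
          refine (abs_add_le _ _).trans (add_le_add ((abs_add_le _ _).trans (le_of_eq ?_))
            ((abs_add_le _ _).trans (le_of_eq ?_)))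
          · rw [abs_mul, abs_mul, abs_of_nonneg eg]
          · rw [abs_mul, abs_mul, abs_of_nonneg ef]
      _ ≤ (C * η t ^ 2 * f t) * g t + (C * η t * f t) * (D * η t * g t)
          + ((C * η t * f t) * (D * η t * g t) + f t * (D * η t ^ 2 * g t)) := by gcongr
      _ = (C + D + 2 * C * D) * η t ^ 2 * (f t * g t) := by ring

/-- The constant is not enlarged here, nor under nonnegative scaling. Hence `r a² + m²` satisfies
symbol bounds uniformly in the frequency `r ≥ 0`. -/
theorem SymbolBound.add {η f f₁ f₂ g g₁ g₂ : ℝ → ℝ} {C : ℝ}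
    (hf : SymbolBound η f f₁ f₂ C) (hg : SymbolBound η g g₁ g₂ C) :
    SymbolBound η (fun t => f t + g t) (fun t => f₁ t + g₁ t) (fun t => f₂ t + g₂ t) C where
  continuousOn := hf.continuousOn.add hg.continuousOn
  continuousOn_deriv := hf.continuousOn_deriv.add hg.continuousOn_deriv
  hasDerivAt t ht := (hf.hasDerivAt t ht).add (hg.hasDerivAt t ht)
  hasDerivAt_deriv t ht := (hf.hasDerivAt_deriv t ht).add (hg.hasDerivAt_deriv t ht)
  bound_deriv t ht := (abs_add_le _ _).trans <| by
    linarith [hf.bound_deriv t ht, hg.bound_deriv t ht]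
  bound_deriv_two t ht := (abs_add_le _ _).trans <| by
    linarith [hf.bound_deriv_two t ht, hg.bound_deriv_two t ht]

theorem SymbolBound.const_mul {η f f₁ f₂ : ℝ → ℝ} {C r : ℝ} (hr : 0 ≤ r)
    (hf : SymbolBound η f f₁ f₂ C) :
    SymbolBound η (fun t => r * f t) (fun t => r * f₁ t) (fun t => r * f₂ t) C where
  continuousOn := continuousOn_const.mul hf.continuousOn
  continuousOn_deriv := continuousOn_const.mul hf.continuousOn_deriv
  hasDerivAt t ht := (hf.hasDerivAt t ht).const_mul r
  hasDerivAt_deriv t ht := (hf.hasDerivAt_deriv t ht).const_mul r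
  bound_deriv t ht := by
    rw [abs_mul, abs_of_nonneg hr]
    nlinarith [mul_le_mul_of_nonneg_left (hf.bound_deriv t ht) hr]
  bound_deriv_two t ht := by
    rw [abs_mul, abs_of_nonneg hr]
    nlinarith [mul_le_mul_of_nonneg_left (hf.bound_deriv_two t ht) hr]

theorem SpeedHyp.symbolBound (ha : SpeedHyp a) :
    ∃ a₁ a₂ C, 0 ≤ C ∧ SymbolBound (eta a) a a₁ a₂ C := by
  obtain ⟨C₁, hC₁, h1⟩ := ha.shape 1 (by simp)
  obtain ⟨C₂, hC₂, h2⟩ := ha.shape 2 (by simp)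
  obtain ⟨hc, hd1, hd2⟩ := hasDerivAt_iteratedDerivWithin ha.contDiffOn
  refine ⟨_, _, max C₁ C₂, by positivity, ha.contDiffOn.continuousOn, hc, hd1, hd2, ?_, ?_⟩
  · intro t ht
    have h := h1 t ht
    have e := ha.eta_pos ht
    have p := ha.pos t ht
    rw [div_le_iff₀ p, pow_one] at h
    refine h.trans ?_
    gcongr
    exact le_max_left _ _
  · intro t ht
    have h := h2 t ht
    have e := ha.eta_pos ht
    have p := ha.pos t ht
    rw [div_le_iff₀ p] at h
    refine h.trans ?_
    gcongr
    exact le_max_right _ _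

/-- Because `A' = a = ηA`, each derivative of `1/A` costs one factor `η`; the second one also uses
the bound on `a'`. -/
theorem SpeedHyp.symbolBound_inv_bigA (ha : SpeedHyp a) :
    ∃ b₁ b₂ C, 0 ≤ C ∧ SymbolBound (eta a) (fun t => (bigA a t)⁻¹) b₁ b₂ C := by
  obtain ⟨a₁, a₂, C, hC, h⟩ := ha.symbolBound
  have hA : ContinuousOn (bigA a) (Ici 0) := ha.contDiffOn_bigA.continuousOn
  have hne : ∀ t ∈ Ici (0 : ℝ), bigA a t ≠ 0 := fun t ht => (ha.bigA_pos ht).ne'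
  have hd : ∀ t, 0 < t → HasDerivAt (bigA a) (a t) t := fun t ht =>
    (ha.hasDerivWithinAt_bigA ht.le).hasDerivAt (Ici_mem_nhds ht)
  refine ⟨fun t => -a t / bigA a t ^ 2,
    fun t => (-a₁ t * bigA a t ^ 2 - -a t * (2 * bigA a t * a t)) / (bigA a t ^ 2) ^ 2,
    C + 2, by positivity, hA.inv₀ hne, ?_, fun t ht => ?_, fun t ht => ?_, fun t ht => ?_,
    fun t ht => ?_⟩
  · exact h.continuousOn.neg.div (hA.pow 2) fun t ht => pow_ne_zero 2 (hne t ht)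
  · exact (hd t ht).inv (hne t ht.le)
  · have := (h.hasDerivAt t ht).neg.div ((hd t ht).pow 2) (pow_ne_zero 2 (hne t ht.le))
    exact this.congr_deriv (by simp)
  · have hp := ha.bigA_pos ht
    have := ha.pos t ht
    rw [abs_div, abs_neg, abs_of_pos this, abs_of_pos (by positivity : 0 < bigA a t ^ 2)]
    have e := ha.eta_pos ht
    calc a t / bigA a t ^ 2 = 1 * eta a t * (bigA a t)⁻¹ := by unfold eta; field_simp
      _ ≤ (C + 2) * eta a t * (bigA a t)⁻¹ := by gcongr; linarith
  · have hp := ha.bigA_pos ht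
    have p := ha.pos t ht
    have hb := h.bound_deriv t ht
    have e : eta a t * bigA a t = a t := by unfold eta; field_simp
    rw [abs_div, abs_of_pos (by positivity : 0 < (bigA a t ^ 2) ^ 2), div_le_iff₀ (by positivity)]
    have : |-a₁ t * bigA a t ^ 2 - -a t * (2 * bigA a t * a t)|
        ≤ |a₁ t| * bigA a t ^ 2 + a t * (2 * bigA a t * a t) := by
      refine (abs_sub _ _).trans (le_of_eq ?_)
      rw [abs_mul, abs_neg, abs_mul, abs_neg, abs_of_pos p,
        abs_of_pos (by positivity : 0 < bigA a t ^ 2),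
        abs_of_pos (by positivity : 0 < 2 * bigA a t * a t)]
    refine this.trans ?_
    calc |a₁ t| * bigA a t ^ 2 + a t * (2 * bigA a t * a t)
        ≤ (C * eta a t * a t) * bigA a t ^ 2 + a t * (2 * bigA a t * a t) := by gcongr
      _ = (C + 2) * eta a t ^ 2 * (bigA a t)⁻¹ * (bigA a t ^ 2) ^ 2 := by
          rw [← e]; field_simp

/-- The product rule applied to `m = μ · a · A⁻¹`, whose three factors all satisfy symbol bounds. -/
theorem MassHyp.symbolBound (ha : SpeedHyp a) (hm : MassHyp a m μ) :
    ∃ m₁ m₂ C, 0 ≤ C ∧ SymbolBound (eta a) m m₁ m₂ C := by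
  obtain ⟨C₁, hC₁, h1⟩ := hm.shape 1 (by simp)
  obtain ⟨C₂, hC₂, h2⟩ := hm.shape 2 (by simp)
  obtain ⟨hc, hd1, hd2⟩ := hasDerivAt_iteratedDerivWithin (hm.contDiffOn_mu ha)
  obtain ⟨a₁, a₂, C, hC, hab⟩ := ha.symbolBound
  obtain ⟨b₁, b₂, D, hD, hb⟩ := ha.symbolBound_inv_bigA
  have e0 : ∀ t, 0 ≤ t → 0 ≤ eta a t := fun t ht => (ha.eta_pos ht).le
  have hμ : ∀ t, 0 ≤ t → 0 ≤ μ t := fun t ht => (hm.mu_pos ha ht).le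
  have hμb : SymbolBound (eta a) μ _ _ (max C₁ C₂) :=
    ⟨(hm.contDiffOn_mu ha).continuousOn, hc, hd1, hd2, fun t ht => by
      have := e0 t ht; have := hμ t ht
      calc _ ≤ C₁ * μ t * eta a t ^ 1 := h1 t ht
        _ = C₁ * eta a t * μ t := by ring
        _ ≤ _ := by gcongr; exact le_max_left _ _, fun t ht => by
      have := e0 t ht; have := hμ t ht
      calc _ ≤ C₂ * μ t * eta a t ^ 2 := h2 t ht
        _ = C₂ * eta a t ^ 2 * μ t := by ring
        _ ≤ _ := by gcongr; exact le_max_right _ _⟩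
  have hη := hab.mul hC hD hb e0 (fun t ht => (ha.pos t ht).le)
    (fun t ht => (inv_pos.2 (ha.bigA_pos ht)).le)
  have hmm := hμb.mul (by positivity) (by positivity) hη e0 hμ (fun t ht => by
    have := ha.pos t ht; have := ha.bigA_pos ht; positivity)
  have heq : ∀ t, 0 ≤ t → m t = μ t * (a t * (bigA a t)⁻¹) := fun t ht => by
    rw [hm.form t ht, eta, div_eq_mul_inv]
  refine ⟨_, _, max C₁ C₂ + (C + D + 2 * C * D) + 2 * max C₁ C₂ * (C + D + 2 * C * D),
    by positivity, hm.contDiffOn.continuousOn, hmm.continuousOn_deriv,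
    fun t ht => (hmm.hasDerivAt t ht).congr_of_eventuallyEq ?_, hmm.hasDerivAt_deriv,
    fun t ht => ?_, fun t ht => ?_⟩
  · filter_upwards [Ici_mem_nhds ht] with s hs using heq s hs
  · rw [heq t ht]; exact hmm.bound_deriv t ht
  · rw [heq t ht]; exact hmm.bound_deriv_two t ht

/-- The use of effectiveness: a positive continuous `μ` tending to infinity has a positive lower
bound, and `η = m/μ`. -/
theorem exists_eta_le_mass (ha : SpeedHyp a) (hm : MassHyp a m μ)
    (heff : Tendsto μ atTop atTop) : ∃ K, ∀ t, 0 ≤ t → eta a t ≤ K * m t := by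
  obtain ⟨T, hT⟩ := (heff.eventually_ge_atTop 1).exists_forall_of_atTop
  have hc : ContinuousOn μ (Icc 0 (max T 0)) :=
    (hm.contDiffOn_mu ha).continuousOn.mono Icc_subset_Ici_self
  obtain ⟨s, hs, hmin⟩ := isCompact_Icc.exists_isMinOn (nonempty_Icc.2 (le_max_right T 0)) hc
  have hsp := hm.mu_pos ha hs.1
  have key : ∀ t, 0 ≤ t → min (μ s) 1 ≤ μ t := fun t ht => by
    rcases le_total t (max T 0) with h | h
    · exact (min_le_left _ _).trans (hmin ⟨ht, h⟩)
    · exact (min_le_right _ _).trans (hT t ((le_max_left _ _).trans h))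
  have hpos : 0 < min (μ s) 1 := lt_min hsp one_pos
  refine ⟨(min (μ s) 1)⁻¹, fun t ht => ?_⟩
  rw [inv_mul_eq_div, le_div_iff₀ hpos, hm.form t ht, mul_comm]
  exact mul_le_mul_of_nonneg_right (key t ht) (ha.eta_pos ht).le

end Scalar

/-! ### Liouville–Green estimate for a perturbed oscillator -/

section Oscillator

/-- Grönwall's inequality: `exp (-N) * G` is nonincreasing. Derivatives are needed only in the
interior, because the equation is given only for positive times. -/
theorem le_exp_mul_of_deriv_le {G G' κ N : ℝ → ℝ} {T : ℝ} (hT : 0 ≤ T)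
    (hG : ContinuousOn G (Icc 0 T)) (hN : ContinuousOn N (Icc 0 T))
    (hG' : ∀ t ∈ Ioo 0 T, HasDerivAt G (G' t) t) (hN' : ∀ t ∈ Ioo 0 T, HasDerivAt N (κ t) t)
    (hle : ∀ t ∈ Ioo 0 T, G' t ≤ κ t * G t) :
    G T ≤ Real.exp (N T - N 0) * G 0 := by
  have hanti : AntitoneOn (fun t => Real.exp (-N t) * G t) (Icc 0 T) := by
    refine antitoneOn_of_hasDerivWithinAt_nonpos (convex_Icc 0 T)
      (f' := fun t => Real.exp (-N t) * -κ t * G t + Real.exp (-N t) * G' t) ?_ ?_ ?_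
    · exact (Real.continuous_exp.comp_continuousOn hN.neg).mul hG
    · intro t ht
      rw [interior_Icc] at ht
      exact (((hN' t ht).neg.exp).mul (hG' t ht)).hasDerivWithinAt
    · intro t ht
      rw [interior_Icc] at ht
      have := mul_le_mul_of_nonneg_left (hle t ht) (Real.exp_pos (-N t)).le
      linarith
  have h := hanti (left_mem_Icc.2 hT) (right_mem_Icc.2 hT) hT
  simp only at h
  calc G T = Real.exp (N T) * (Real.exp (-N T) * G T) := by
        rw [← mul_assoc, ← Real.exp_add]; simp
    _ ≤ Real.exp (N T) * (Real.exp (-N 0) * G 0) :=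
        mul_le_mul_of_nonneg_left h (Real.exp_pos _).le
    _ = _ := by rw [← mul_assoc, ← Real.exp_add, sub_eq_add_neg]

variable {H : Type*} [NormedAddCommGroup H] [NormedSpace ℝ H]

variable {η m Λ Λ₁ Λ₂ N : ℝ → ℝ} {C K M ε T : ℝ} {w w₁ f : ℝ → H}

/-- Liouville–Green energy of `w` with respect to the squared frequency `Λ`. -/
def wkbEnergy (Λ Λ₁ : ℝ → ℝ) (w w₁ : ℝ → H) (t : ℝ) : ℝ :=
  ‖(√√(Λ t))⁻¹ • (w₁ t + (Λ₁ t / (4 * Λ t)) • w t)‖ ^ 2 + ‖√√(Λ t) • w t‖ ^ 2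

theorem wkbEnergy_eq {t : ℝ} (h : 0 < Λ t) :
    wkbEnergy Λ Λ₁ w w₁ t =
      ‖w₁ t + (Λ₁ t / (4 * Λ t)) • w t‖ ^ 2 / √(Λ t) + √(Λ t) * ‖w t‖ ^ 2 := by
  have hs : 0 < √(Λ t) := Real.sqrt_pos.2 h
  have e : √√(Λ t) ^ 2 = √(Λ t) := Real.sq_sqrt hs.le
  rw [wkbEnergy, norm_smul, norm_smul, mul_pow, mul_pow, Real.norm_eq_abs, Real.norm_eq_abs,
    sq_abs, sq_abs, inv_pow, e]
  ring

/-- The logarithmic derivative of `Λ^(1/4)` is `Λ'/(4Λ)`; this is where the correction in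
`wkbEnergy` comes from. -/
theorem hasDerivAt_sqrt_sqrt {t : ℝ} (h : 0 < Λ t) (hd : HasDerivAt Λ (Λ₁ t) t) :
    HasDerivAt (fun s => √√(Λ s)) (Λ₁ t / (4 * Λ t) * √√(Λ t)) t := by
  have hs : 0 < √(Λ t) := Real.sqrt_pos.2 h
  have hy : 0 < √√(Λ t) := Real.sqrt_pos.2 hs
  refine ((hd.sqrt h.ne').sqrt hs.ne').congr_deriv ?_
  have e : √√(Λ t) ^ 2 = √(Λ t) := Real.sq_sqrt hs.le
  have e' : √(Λ t) ^ 2 = Λ t := Real.sq_sqrt h.le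
  have e4 : Λ t = √√(Λ t) ^ 4 := by linear_combination -e' - (√√(Λ t) ^ 2 + √(Λ t)) * e
  generalize √√(Λ t) = y at *
  rw [← e, e4]
  field_simp
  norm_num

variable [InnerProductSpace ℂ H]

theorem hasDerivAt_norm_sq_of_complex {f : ℝ → H} {f' : H} {t : ℝ} (hf : HasDerivAt f f' t) :
    HasDerivAt (fun s => ‖f s‖ ^ 2) (2 * (inner ℂ (f t) f').re) t := by
  have h := (Complex.reCLM.hasFDerivAt.comp_hasDerivAt t (hf.inner ℂ hf))
  refine (h.congr_of_eventuallyEq (.of_forall fun s => ?_)).congr_deriv ?_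
  · simp [← inner_self_eq_norm_sq (𝕜 := ℂ)]
  · have := inner_re_symm (𝕜 := ℂ) (f t) f'
    simp only [RCLike.re_eq_complex_re] at this
    simp [← this]; ring

theorem two_mul_re_inner_le {x y g : H} {β κ ε : ℝ} (hε : 0 ≤ ε) (hβ : |β| ≤ κ) (hg : ‖g‖ ≤ ε * ‖y‖) :
    2 * (inner ℂ x (β • y - g)).re ≤ (κ + ε) * (‖x‖ ^ 2 + ‖y‖ ^ 2) := by
  have h1 : (inner ℂ x (β • y - g)).re ≤ ‖x‖ * ‖β • y - g‖ := re_inner_le_norm (𝕜 := ℂ) _ _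
  have h2 : ‖β • y - g‖ ≤ (κ + ε) * ‖y‖ := by
    refine (norm_sub_le _ _).trans ?_
    rw [norm_smul, Real.norm_eq_abs, add_mul]
    gcongr
  have h3 : ‖x‖ * ‖β • y - g‖ ≤ ‖x‖ * ((κ + ε) * ‖y‖) := by gcongr
  have h4 : 0 ≤ κ + ε := add_nonneg ((abs_nonneg _).trans hβ) hε
  nlinarith [mul_nonneg h4 (sq_nonneg (‖x‖ - ‖y‖))]

variable [IsScalarTower ℝ ℂ H]

theorem re_inner_real_smul_right (x y : H) (r : ℝ) :
    (inner ℂ x (r • y)).re = r * (inner ℂ x y).re := by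
  rw [← algebraMap_smul ℂ r y, inner_smul_right]
  simp

/-- The derivative of the Liouville–Green energy along `w'' = -Λ w - f`. -/
theorem hasDerivAt_wkbEnergy {t : ℝ} (h : 0 < Λ t) (hΛ : HasDerivAt Λ (Λ₁ t) t)
    (hΛ₁ : HasDerivAt Λ₁ (Λ₂ t) t) (hw : HasDerivAt w (w₁ t) t)
    (hw₁ : HasDerivAt w₁ (-(Λ t • w t) - f t) t) :
    HasDerivAt (wkbEnergy Λ Λ₁ w w₁)
      (2 * (inner ℂ ((√√(Λ t))⁻¹ • (w₁ t + (Λ₁ t / (4 * Λ t)) • w t))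
        (((Λ₂ t / (4 * Λ t) - Λ₁ t ^ 2 / (4 * Λ t ^ 2) - (Λ₁ t / (4 * Λ t)) ^ 2) / √(Λ t)) •
          √√(Λ t) • w t - (√√(Λ t))⁻¹ • f t)).re) t := by
  have hs : 0 < √(Λ t) := Real.sqrt_pos.2 h
  have hy : 0 < √√(Λ t) := Real.sqrt_pos.2 hs
  have e : √√(Λ t) ^ 2 = √(Λ t) := Real.sq_sqrt hs.le
  have e' : √(Λ t) ^ 2 = Λ t := Real.sq_sqrt h.le
  have hyd := hasDerivAt_sqrt_sqrt h hΛ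
  have hz : HasDerivAt (fun s => Λ₁ s / (4 * Λ s))
      (Λ₂ t / (4 * Λ t) - Λ₁ t ^ 2 / (4 * Λ t ^ 2)) t := by
    refine (hΛ₁.div (hΛ.const_mul 4) (by positivity)).congr_deriv ?_
    field_simp
  have hq := hyd.smul hw
  have hp := (hyd.inv hy.ne').smul (hw₁.add (hz.smul hw))
  have hG := (hasDerivAt_norm_sq_of_complex hp).add (hasDerivAt_norm_sq_of_complex hq)
  refine hG.congr_deriv ?_
  simp only [Pi.smul_apply', Pi.add_apply, Pi.inv_apply]
  set y := √√(Λ t)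
  set z := Λ₁ t / (4 * Λ t)
  set b := Λ₂ t / (4 * Λ t) - Λ₁ t ^ 2 / (4 * Λ t ^ 2)
  have e4 : Λ t = (y ^ 2) ^ 2 := by rw [e, e']
  rw [← e, e4]
  set p := y⁻¹ • (w₁ t + z • w t) with hp_def
  -- With `q = y • w`, these identities read `q' = y² p` and `p' = -y² q + error`. The two `y²`
  -- terms cancel in the derivative of `‖p‖² + ‖q‖²`.
  have h1 : y • w₁ t + (z * y) • w t = (y ^ 2) • p := by
    rw [hp_def]
    match_scalars <;> field_simp
  have h2 : y⁻¹ • (-((y ^ 2) ^ 2 • w t) - f t + (z • w₁ t + b • w t)) +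
      (-(z * y) / y ^ 2) • (w₁ t + z • w t) =
      -(y ^ 2) • y • w t + (((b - z ^ 2) / y ^ 2) • y • w t - y⁻¹ • f t) := by
    match_scalars <;> field_simp <;> ring
  have := inner_re_symm (𝕜 := ℂ) p (y • w t)
  simp only [RCLike.re_eq_complex_re] at this
  rw [h1, h2, inner_add_right, Complex.add_re, re_inner_real_smul_right _ _ (-y ^ 2), this,
    re_inner_real_smul_right _ p (y ^ 2)]
  ring

/-- Uniform energy bound for the perturbed oscillator `w'' = -Λ w - f`. -/
theorem oscillator_energy_le (hC : 0 ≤ C) (hT : 0 ≤ T) (hε : 0 ≤ ε)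
    (hεT : ε * T ≤ 1) (hΛ : SymbolBound η Λ Λ₁ Λ₂ C)
    (hη : ∀ t, 0 ≤ t → 0 ≤ η t) (hm : ∀ t, 0 ≤ t → 0 < m t)
    (hmΛ : ∀ t, 0 ≤ t → m t ^ 2 ≤ Λ t) (hηm : ∀ t, 0 ≤ t → η t ≤ K * m t)
    (hN : ContinuousOn N (Icc 0 T)) (hN' : ∀ t, 0 < t → HasDerivAt N (η t ^ 2 / m t) t)
    (hNM : N T - N 0 ≤ M)
    (hw : ∀ t, 0 < t → HasDerivAt w (w₁ t) t)
    (hw₁ : ∀ t, 0 < t → HasDerivAt w₁ (-(Λ t • w t) - f t) t)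
    (hwc : ContinuousOn w (Ici 0)) (hw₁c : ContinuousOn w₁ (Ici 0))
    (hf : ∀ t ∈ Ioo 0 T, ‖f t‖ ≤ ε * m t * ‖w t‖) :
    ‖w₁ T‖ ^ 2 + Λ T * ‖w T‖ ^ 2 ≤
      (2 + 2 * (C * K) ^ 2) ^ 2 * Real.exp ((C + C ^ 2) * M + 1) *
        (√(Λ T) / √(Λ 0) * (‖w₁ 0‖ ^ 2 + Λ 0 * ‖w 0‖ ^ 2)) := by
  have hΛp : ∀ t, 0 ≤ t → 0 < Λ t := fun t ht => (pow_pos (hm t ht) 2).trans_le (hmΛ t ht)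
  have hms : ∀ t, 0 ≤ t → m t ≤ √(Λ t) := fun t ht => Real.le_sqrt_of_sq_le (hmΛ t ht)
  have hzb : ∀ t, 0 ≤ t → |Λ₁ t / (4 * Λ t)| ≤ C * η t / 4 := fun t ht => by
    have := hΛp t ht
    rw [abs_div, abs_of_pos (by positivity : 0 < 4 * Λ t), div_le_iff₀ (by positivity)]
    linarith [hΛ.bound_deriv t ht]
  have hG : wkbEnergy Λ Λ₁ w w₁ T ≤
      Real.exp (((C + C ^ 2) * N T + ε * T) - ((C + C ^ 2) * N 0 + ε * 0)) *
        wkbEnergy Λ Λ₁ w w₁ 0 := by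
    -- The Liouville–Green error contributes `η²/m`, with primitive `N`; the perturbation `f`
    -- contributes the constant rate `ε`.
    refine le_exp_mul_of_deriv_le (N := fun t => (C + C ^ 2) * N t + ε * t)
      (κ := fun t => (C + C ^ 2) * (η t ^ 2 / m t) + ε) hT ?_ (by fun_prop)
      (fun t ht => hasDerivAt_wkbEnergy (hΛp t ht.1.le) (hΛ.hasDerivAt t ht.1)
        (hΛ.hasDerivAt_deriv t ht.1) (hw t ht.1) (hw₁ t ht.1))
      (fun t ht => (((hN' t ht.1).const_mul _).add ((hasDerivAt_id t).const_mul ε)).congr_deriv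
        (by simp)) ?_
    · have hc := hΛ.continuousOn.mono (Icc_subset_Ici_self : Icc 0 T ⊆ Ici 0)
      have hc₁ := hΛ.continuousOn_deriv.mono (Icc_subset_Ici_self : Icc 0 T ⊆ Ici 0)
      have hwc' := hwc.mono (Icc_subset_Ici_self : Icc 0 T ⊆ Ici 0)
      have hw₁c' := hw₁c.mono (Icc_subset_Ici_self : Icc 0 T ⊆ Ici 0)
      have hy : ContinuousOn (fun t => √√(Λ t)) (Icc 0 T) := hc.sqrt.sqrt
      have hyi : ContinuousOn (fun t => (√√(Λ t))⁻¹) (Icc 0 T) := hy.inv₀ fun t ht =>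
        (Real.sqrt_pos.2 (Real.sqrt_pos.2 (hΛp t ht.1))).ne'
      have hz : ContinuousOn (fun t => Λ₁ t / (4 * Λ t)) (Icc 0 T) :=
        hc₁.div (continuousOn_const.mul hc) fun t ht => (mul_pos four_pos (hΛp t ht.1)).ne'
      exact ((hyi.smul (hw₁c'.add (hz.smul hwc'))).norm.pow 2).add ((hy.smul hwc').norm.pow 2)
    · intro t ht
      have h0 : 0 ≤ t := ht.1.le
      have hL := hΛp t h0
      have hmt := hm t h0
      have hmst := hms t h0
      have hηt := hη t h0
      refine two_mul_re_inner_le hε ?_ ?_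
      · have hs : 0 < √(Λ t) := Real.sqrt_pos.2 hL
        rw [abs_div, abs_of_pos hs, ← mul_div_assoc]
        have b1 : |Λ₂ t / (4 * Λ t)| ≤ C * η t ^ 2 / 4 := by
          rw [abs_div, abs_of_pos (by positivity : 0 < 4 * Λ t), div_le_iff₀ (by positivity)]
          linarith [hΛ.bound_deriv_two t h0]
        have b2 : (Λ₁ t / (4 * Λ t)) ^ 2 ≤ (C * η t / 4) ^ 2 := by
          rw [← sq_abs]; exact pow_le_pow_left₀ (abs_nonneg _) (hzb t h0) 2
        have b3 : Λ₁ t ^ 2 / (4 * Λ t ^ 2) = 4 * (Λ₁ t / (4 * Λ t)) ^ 2 := by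
          field_simp
        -- The two squares add up to `5 (Λ'/(4Λ))² ≤ 5C²η²/16`, and the first term is at most
        -- `Cη²/4`.
        have b4 : |Λ₂ t / (4 * Λ t) - Λ₁ t ^ 2 / (4 * Λ t ^ 2) - (Λ₁ t / (4 * Λ t)) ^ 2|
            ≤ (C + C ^ 2) * η t ^ 2 := by
          rw [b3, abs_le]
          rw [abs_le] at b1
          have := sq_nonneg (Λ₁ t / (4 * Λ t))
          have h5 : 0 ≤ C * η t ^ 2 := by positivity
          have h6 : 0 ≤ C ^ 2 * η t ^ 2 := by positivity
          constructor <;> nlinarith [b1.1, b1.2]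
        gcongr
      · have hs : 0 < √(Λ t) := Real.sqrt_pos.2 hL
        have hy : 0 < √√(Λ t) := Real.sqrt_pos.2 hs
        have e : √√(Λ t) ^ 2 = √(Λ t) := Real.sq_sqrt hs.le
        rw [norm_smul, norm_smul, Real.norm_of_nonneg hy.le, norm_inv, Real.norm_of_nonneg hy.le,
          inv_mul_le_iff₀ hy]
        calc ‖f t‖ ≤ ε * m t * ‖w t‖ := hf t ht
          _ ≤ ε * √(Λ t) * ‖w t‖ := by gcongr
          _ = _ := by linear_combination (-ε * ‖w t‖) * e
  have hexp : Real.exp (((C + C ^ 2) * N T + ε * T) - ((C + C ^ 2) * N 0 + ε * 0)) ≤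
      Real.exp ((C + C ^ 2) * M + 1) := by
    refine Real.exp_le_exp.2 ?_
    nlinarith [mul_le_mul_of_nonneg_left hNM (by positivity : 0 ≤ C + C ^ 2)]
  -- Here `η ≤ K m ≤ K √Λ` makes the correction comparable to the potential part, so that the plain
  -- and the Liouville–Green energies are equivalent.
  have hz2 : ∀ t, 0 ≤ t → (Λ₁ t / (4 * Λ t)) ^ 2 ≤ (C * K) ^ 2 * Λ t := fun t ht => by
    have h1 : |Λ₁ t / (4 * Λ t)| ≤ C * K * m t := by
      have := mul_le_mul_of_nonneg_left (hηm t ht) hC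
      have h2 := mul_nonneg hC (hη t ht)
      linarith [hzb t ht]
    calc (Λ₁ t / (4 * Λ t)) ^ 2 = |Λ₁ t / (4 * Λ t)| ^ 2 := (sq_abs _).symm
      _ ≤ (C * K * m t) ^ 2 := pow_le_pow_left₀ (abs_nonneg _) h1 2
      _ = (C * K) ^ 2 * m t ^ 2 := by ring
      _ ≤ _ := by gcongr; exact hmΛ t ht
  have hsplit : ∀ (x y : H), ‖x + y‖ ^ 2 ≤ 2 * ‖x‖ ^ 2 + 2 * ‖y‖ ^ 2 := fun x y => by
    have := norm_add_le x y
    nlinarith [sq_nonneg (‖x‖ - ‖y‖), norm_nonneg (x + y)]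
  have hzw : ∀ t, 0 ≤ t → ‖(Λ₁ t / (4 * Λ t)) • w t‖ ^ 2 ≤ (C * K) ^ 2 * Λ t * ‖w t‖ ^ 2 :=
    fun t ht => by
      rw [norm_smul, mul_pow, Real.norm_eq_abs, sq_abs]
      exact mul_le_mul_of_nonneg_right (hz2 t ht) (by positivity)
  -- The constant of this equivalence; it is paid at time `0` and at time `T`, hence the square in
  -- the conclusion.
  set B := 2 + 2 * (C * K) ^ 2 with hB
  have hinit : wkbEnergy Λ Λ₁ w w₁ 0 ≤ B * ((‖w₁ 0‖ ^ 2 + Λ 0 * ‖w 0‖ ^ 2) / √(Λ 0)) := by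
    have hs : 0 < √(Λ 0) := Real.sqrt_pos.2 (hΛp 0 le_rfl)
    rw [wkbEnergy_eq (hΛp 0 le_rfl), ← mul_div_assoc, div_add' _ _ _ hs.ne']
    gcongr
    have e : √(Λ 0) * ‖w 0‖ ^ 2 * √(Λ 0) = Λ 0 * ‖w 0‖ ^ 2 := by
      rw [mul_right_comm, Real.mul_self_sqrt (hΛp 0 le_rfl).le]
    rw [e]
    have h1 := hsplit (w₁ 0) ((Λ₁ 0 / (4 * Λ 0)) • w 0)
    have h2 := hzw 0 le_rfl
    have h3 : 0 ≤ Λ 0 * ‖w 0‖ ^ 2 := mul_nonneg (hΛp 0 le_rfl).le (by positivity)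
    have h4 : 0 ≤ (C * K) ^ 2 * ‖w₁ 0‖ ^ 2 := by positivity
    rw [hB]
    nlinarith
  have hfinal : ‖w₁ T‖ ^ 2 + Λ T * ‖w T‖ ^ 2 ≤ B * (√(Λ T) * wkbEnergy Λ Λ₁ w w₁ T) := by
    have hs : 0 < √(Λ T) := Real.sqrt_pos.2 (hΛp T hT)
    have e : √(Λ T) * (√(Λ T) * ‖w T‖ ^ 2) = Λ T * ‖w T‖ ^ 2 := by
      rw [← mul_assoc, Real.mul_self_sqrt (hΛp T hT).le]
    rw [wkbEnergy_eq (hΛp T hT), mul_add, mul_div_cancel₀ _ hs.ne', e]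
    have h1 := hsplit (w₁ T + (Λ₁ T / (4 * Λ T)) • w T) (-((Λ₁ T / (4 * Λ T)) • w T))
    rw [add_neg_cancel_right, norm_neg] at h1
    have h2 := hzw T hT
    have h3 : 0 ≤ Λ T * ‖w T‖ ^ 2 := mul_nonneg (hΛp T hT).le (by positivity)
    have h4 : 0 ≤ (C * K) ^ 2 * ‖w₁ T + (Λ₁ T / (4 * Λ T)) • w T‖ ^ 2 := by positivity
    rw [hB]
    nlinarith
  have hB0 : 0 ≤ B := by positivity
  have hE0 : 0 ≤ wkbEnergy Λ Λ₁ w w₁ 0 := by unfold wkbEnergy; positivity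
  calc ‖w₁ T‖ ^ 2 + Λ T * ‖w T‖ ^ 2 ≤ B * (√(Λ T) * wkbEnergy Λ Λ₁ w w₁ T) := hfinal
    _ ≤ B * (√(Λ T) * (Real.exp ((C + C ^ 2) * M + 1) *
          (B * ((‖w₁ 0‖ ^ 2 + Λ 0 * ‖w 0‖ ^ 2) / √(Λ 0))))) := by
        gcongr
        exact hG.trans (by gcongr)
    _ = _ := by ring

end Oscillator

/-! ### Multipliers on `L²` and differentiation of `L²`-valued curves -/

section FrequencySide

open FourierTransform

variable {n : ℕ}

/-- Multiplication by an essentially bounded function, as an operator on `L²(ℝⁿ)`. -/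
def mulOp (g : Lp ℂ ∞ (volume : Measure (EuclideanSpace ℝ (Fin n)))) : L2 n →L[ℂ] L2 n :=
  LinearMap.mkContinuous
    { toFun := fun f => g • f
      map_add' := fun f₁ f₂ => Lp.add_smul g f₁ f₂
      map_smul' := fun c f => (Lp.smul_comm c g f).symm } ‖g‖ fun f => Lp.norm_smul_le g f

theorem coeFn_mulOp (g : Lp ℂ ∞ (volume : Measure (EuclideanSpace ℝ (Fin n)))) (f : L2 n) :
    mulOp g f =ᵐ[volume] fun x => g x * f x :=
  Lp.coeFn_lpSMul (r := 2) g f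

theorem coeFn_mulOp_toLp {g : EuclideanSpace ℝ (Fin n) → ℂ} (hg : MemLp g ∞ volume) (f : L2 n) :
    mulOp (hg.toLp g) f =ᵐ[volume] fun x => g x * f x := by
  filter_upwards [coeFn_mulOp (hg.toLp g) f, hg.coeFn_toLp] with x h1 h2
  rw [h1, h2]

theorem toTemperedDistribution_mulOp {g : EuclideanSpace ℝ (Fin n) → ℂ}
    (hg : g.HasTemperateGrowth) (hg' : MemLp g ∞ volume) (f : L2 n) :
    (mulOp (hg'.toLp g) f : 𝓢'(EuclideanSpace ℝ (Fin n), ℂ)) =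
      smulLeftCLM ℂ g (f : 𝓢'(EuclideanSpace ℝ (Fin n), ℂ)) :=
  Lp.toTemperedDistribution_smul_eq hg hg' f

theorem toTemperedDistribution_injective {f g : L2 n}
    (h : (f : 𝓢'(EuclideanSpace ℝ (Fin n), ℂ)) = (g : 𝓢'(EuclideanSpace ℝ (Fin n), ℂ))) :
    f = g := by
  have hk := Lp.ker_toTemperedDistributionCLM_eq_bot (F := ℂ)
    (μ := (volume : Measure (EuclideanSpace ℝ (Fin n)))) (p := 2)
  exact LinearMap.ker_eq_bot.1 hk h

/-- The weight `(1 + |ξ|²)⁻¹`. -/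
def resolventWeight (x : EuclideanSpace ℝ (Fin n)) : ℂ := (((1 + ‖x‖ ^ 2) ^ (-1 : ℝ) : ℝ) : ℂ)

theorem resolventWeight_eq (x : EuclideanSpace ℝ (Fin n)) :
    resolventWeight x = (((1 + ‖x‖ ^ 2)⁻¹ : ℝ) : ℂ) := by
  rw [resolventWeight, Real.rpow_neg_one]

theorem resolventWeight_ne_zero (x : EuclideanSpace ℝ (Fin n)) : resolventWeight x ≠ 0 := by
  rw [resolventWeight_eq]
  exact Complex.ofReal_ne_zero.2 (by positivity)

theorem hasTemperateGrowth_resolventWeight :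
    (resolventWeight (n := n)).HasTemperateGrowth := by
  unfold resolventWeight
  fun_prop

/-- The weight turns symbols of order at most two into bounded multipliers, which act on `L²` itself
and not only on distributions. -/
theorem memLp_resolventWeight_mul {h : EuclideanSpace ℝ (Fin n) → ℂ} {C : ℝ}
    (hh : h.HasTemperateGrowth) (hC : ∀ x, ‖h x‖ ≤ C * (1 + ‖x‖ ^ 2)) :
    MemLp (resolventWeight * h) ∞ volume := by
  refine memLp_top_of_bound
    ((hasTemperateGrowth_resolventWeight.mul hh).1.continuous.aestronglyMeasurable) C
    (.of_forall fun x => ?_)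
  rw [Pi.mul_apply, norm_mul, resolventWeight_eq, Complex.norm_real,
    Real.norm_of_nonneg (by positivity), inv_mul_le_iff₀ (by positivity), mul_comm]
  exact hC x

theorem memLp_resolventWeight : MemLp (resolventWeight (n := n)) ∞ volume := by
  have := memLp_resolventWeight_mul (n := n) (h := fun _ => 1) (C := 1) (by fun_prop)
    (fun x => by simp)
  convert this using 1
  ext x; simp

/-- After multiplication by the weight both sides are bounded multipliers applied to `L²` functions,
so they agree almost everywhere; the nowhere vanishing weight is then cancelled pointwise. -/
theorem ae_eq_of_eq_smulLeftCLM {h : EuclideanSpace ℝ (Fin n) → ℂ} {C : ℝ}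
    (hh : h.HasTemperateGrowth) (hC : ∀ x, ‖h x‖ ≤ C * (1 + ‖x‖ ^ 2)) {f g : L2 n}
    (hfg : (g : 𝓢'(EuclideanSpace ℝ (Fin n), ℂ)) =
      smulLeftCLM ℂ h (f : 𝓢'(EuclideanSpace ℝ (Fin n), ℂ))) :
    g =ᵐ[volume] fun x => h x * f x := by
  have hw := hasTemperateGrowth_resolventWeight (n := n)
  have hwh := memLp_resolventWeight_mul hh hC
  have key : mulOp (memLp_resolventWeight.toLp _) g = mulOp (hwh.toLp _) f := by
    apply toTemperedDistribution_injective
    rw [toTemperedDistribution_mulOp hw, toTemperedDistribution_mulOp (hw.mul hh), hfg,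
      smulLeftCLM_smulLeftCLM_apply hh hw, mul_comm]
  filter_upwards [coeFn_mulOp_toLp memLp_resolventWeight g, coeFn_mulOp_toLp hwh f] with x h1 h2
  rw [key, h2, Pi.mul_apply, mul_assoc] at h1
  exact (mul_left_cancel₀ (resolventWeight_ne_zero x) h1).symm

theorem coeFn_fourier_of_isWeakPartial {j : Fin n} {f g : L2 n} (h : IsWeakPartial j f g) :
    (𝓕 g : L2 n) =ᵐ[volume] fun x => (2 * Real.pi * Complex.I * (x j : ℂ)) * (𝓕 f : L2 n) x := by
  have hin : (fun x : EuclideanSpace ℝ (Fin n) =>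
      ((inner ℝ x (EuclideanSpace.single j (1 : ℝ)) : ℝ) : ℂ)).HasTemperateGrowth := by fun_prop
  have hfun : (fun x : EuclideanSpace ℝ (Fin n) => 2 * Real.pi * Complex.I * (x j : ℂ)) =
      (2 * Real.pi * Complex.I : ℂ) • fun x : EuclideanSpace ℝ (Fin n) =>
        ((inner ℝ x (EuclideanSpace.single j (1 : ℝ)) : ℝ) : ℂ) := by
    ext x; simp [EuclideanSpace.inner_single_right]
  refine ae_eq_of_eq_smulLeftCLM (C := 2 * Real.pi) (by rw [hfun]; fun_prop) (fun x => ?_) ?_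
  · have h1 : ‖x j‖ ≤ ‖x‖ := PiLp.norm_apply_le x j
    have h2 : ‖x‖ ≤ 1 + ‖x‖ ^ 2 := by nlinarith [sq_nonneg (‖x‖ - 1), norm_nonneg x]
    simp only [norm_mul, Complex.norm_real, Complex.norm_I, mul_one, Complex.norm_ofNat,
      Real.norm_of_nonneg Real.pi_pos.le]
    gcongr
    exact h1.trans h2
  · rw [hfun, smulLeftCLM_smul hin, ← Lp.fourier_toTemperedDistribution_eq, ← h,
      fourier_lineDerivOp_eq, Lp.fourier_toTemperedDistribution_eq]
    rfl

theorem fourier_laplacian_eq_smulLeftCLM (f : 𝓢'(EuclideanSpace ℝ (Fin n), ℂ)) :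
    𝓕 (Δ f) = -smulLeftCLM ℂ (fun x => ((4 * Real.pi ^ 2 * ‖x‖ ^ 2 : ℝ) : ℂ)) (𝓕 f) := by
  have h : (fun x : EuclideanSpace ℝ (Fin n) => ((4 * Real.pi ^ 2 * ‖x‖ ^ 2 : ℝ) : ℂ)) =
      (4 * Real.pi ^ 2 : ℂ) • fun x => ((‖x‖ ^ 2 : ℝ) : ℂ) := by
    ext x; simp
  have h3 : ∀ g : 𝓢'(EuclideanSpace ℝ (Fin n), ℂ), (-(4 * Real.pi ^ 2) : ℂ) • g =
      -((4 * Real.pi ^ 2 : ℂ) • g) := fun g => by ext φ; simp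
  have h2 : ∀ g : 𝓢'(EuclideanSpace ℝ (Fin n), ℂ),
      (-(2 * Real.pi) ^ 2 : ℝ) • g = (-(4 * Real.pi ^ 2) : ℂ) • g := fun g => by
    ext φ
    simp
    ring_nf
    simp
  rw [laplacian_eq_fourierMultiplierCLM, fourierMultiplierCLM_apply, h,
    smulLeftCLM_smul (by fun_prop), h2, FourierTransform.fourier_smul, fourier_fourierInv_eq,
    h3]
  rfl

/-- Evaluation of an `L²` function as a distribution at a test function. -/
def pairing (φ : 𝓢(EuclideanSpace ℝ (Fin n), ℂ)) : L2 n →L[ℂ] ℂ :=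
  (PointwiseConvergenceCLM.evalCLM (RingHom.id ℂ) ℂ φ) ∘L
    Lp.toTemperedDistributionCLM ℂ (volume : Measure (EuclideanSpace ℝ (Fin n))) 2

/-- A weak derivative that is norm continuous is a strong one: `W` minus a primitive of `R` has
constant pairings with all test functions, so it is constant. -/
theorem hasDerivAt_of_pairing {W R : ℝ → L2 n} (hR : ContinuousOn R (Ici 0))
    (h : ∀ φ : 𝓢(EuclideanSpace ℝ (Fin n), ℂ), ∀ t, 0 < t →
      HasDerivAt (fun s => (W s : 𝓢'(EuclideanSpace ℝ (Fin n), ℂ)) φ)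
        ((R t : 𝓢'(EuclideanSpace ℝ (Fin n), ℂ)) φ) t) {t : ℝ} (ht : 0 < t) :
    HasDerivAt W (R t) t := by
  obtain ⟨P, -, hP⟩ := exists_primitive_of_continuousOn_Ici hR
  have key : ∀ s, 0 < s → W s = P s + (W 1 - P 1) := by
    intro s hs
    have : W s - P s = W 1 - P 1 := by
      apply toTemperedDistribution_injective
      ext φ
      have hd : ∀ τ ∈ Ioi (0 : ℝ), HasDerivAt (fun τ => pairing φ (W τ - P τ)) 0 τ := by
        intro τ hτ
        have h1 := ((pairing φ).restrictScalars ℝ).hasFDerivAt.comp_hasDerivAt τ (hP τ hτ.le)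
        have h2 := (h φ τ hτ).sub h1
        refine (h2.congr_of_eventuallyEq (.of_forall fun σ => ?_)).congr_deriv ?_
        · exact map_sub (pairing φ) _ _
        · exact sub_self _
      exact (convex_Ioi (0 : ℝ)).is_const_of_fderivWithin_eq_zero (𝕜 := ℝ)
        (f := fun τ => pairing φ (W τ - P τ))
        (fun τ hτ => (hd τ hτ).differentiableAt.differentiableWithinAt)
        (fun τ hτ => by
          rw [fderivWithin_of_isOpen isOpen_Ioi hτ, (hd τ hτ).hasFDerivAt.fderiv]
          ext; simp) hs (mem_Ioi.2 one_pos)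
    rw [← this]; abel
  refine ((hP t ht.le).add_const (W 1 - P 1)).congr_of_eventuallyEq ?_
  filter_upwards [Ioi_mem_nhds ht] with s hs using key s hs

end FrequencySide

/-! ### Localisation of the equation to frequency bands -/

section Band

open FourierTransform

variable {n : ℕ} {a m : ℝ → ℝ} {u₀ u₁ : L2 n} {u : ℝ → L2 n}

/-- The symbol `4π²|ξ|²` of `-Δ`. -/
def laplaceSymbol (x : EuclideanSpace ℝ (Fin n)) : ℝ := 4 * Real.pi ^ 2 * ‖x‖ ^ 2

theorem laplaceSymbol_nonneg (x : EuclideanSpace ℝ (Fin n)) : 0 ≤ laplaceSymbol x := by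
  unfold laplaceSymbol; positivity

theorem measurable_laplaceSymbol : Measurable (laplaceSymbol (n := n)) := by
  unfold laplaceSymbol; fun_prop

theorem hasTemperateGrowth_laplaceSymbol :
    (fun x : EuclideanSpace ℝ (Fin n) => (laplaceSymbol x : ℂ)).HasTemperateGrowth := by
  unfold laplaceSymbol; fun_prop

theorem norm_laplaceSymbol_le (x : EuclideanSpace ℝ (Fin n)) :
    ‖(laplaceSymbol x : ℂ)‖ ≤ 4 * Real.pi ^ 2 * (1 + ‖x‖ ^ 2) := by
  rw [Complex.norm_real, Real.norm_of_nonneg (laplaceSymbol_nonneg x), laplaceSymbol]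
  gcongr
  linarith

theorem pairing_apply (φ : 𝓢(EuclideanSpace ℝ (Fin n), ℂ)) (f : L2 n) :
    pairing φ f = (f : 𝓢'(EuclideanSpace ℝ (Fin n), ℂ)) φ := rfl

theorem pairing_real_smul (φ : 𝓢(EuclideanSpace ℝ (Fin n), ℂ)) (c : ℝ) (f : L2 n) :
    pairing φ (c • f) = (c : ℂ) * pairing φ f :=
  (((pairing φ).restrictScalars ℝ).map_smul c f).trans Complex.real_smul

theorem continuous_fourier_L2 : Continuous (fun f : L2 n => 𝓕 f) :=
  (Lp.fourierTransformₗᵢ (EuclideanSpace ℝ (Fin n)) ℂ).continuous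

theorem IsEnergySolution.hasDerivWithinAt (hu : IsEnergySolution a m u₀ u₁ u) {t : ℝ}
    (ht : 0 ≤ t) : HasDerivWithinAt u (timeDeriv u t) (Ici 0) t :=
  (hu.contDiffOn.differentiableOn (by norm_num) t ht).hasDerivWithinAt

theorem IsEnergySolution.continuousOn_timeDeriv (hu : IsEnergySolution a m u₀ u₁ u) :
    ContinuousOn (timeDeriv u) (Ici 0) :=
  hu.contDiffOn.continuousOn_derivWithin (uniqueDiffOn_Ici 0) (by norm_num)

theorem hasDerivAt_fourier {f : ℝ → L2 n} {f' : L2 n} {t : ℝ} (h : HasDerivAt f f' t) :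
    HasDerivAt (fun s => 𝓕 (f s)) (𝓕 f') t :=
  (((Lp.fourierTransformₗᵢ (EuclideanSpace ℝ (Fin n)) ℂ).toContinuousLinearEquiv :
    L2 n →L[ℂ] L2 n).restrictScalars ℝ).hasFDerivAt.comp_hasDerivAt t h

/-- The equation on the Fourier side, after multiplication by `(1 + |ξ|²)⁻¹`, holds in `L²`. -/
theorem IsEnergySolution.hasDerivAt_weighted (ha : ContinuousOn a (Ici 0))
    (hm : ContinuousOn m (Ici 0)) (hu : IsEnergySolution a m u₀ u₁ u) {t : ℝ} (ht : 0 < t) :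
    HasDerivAt (fun s => mulOp (memLp_resolventWeight.toLp _) (𝓕 (timeDeriv u s)))
      (-(a t ^ 2 • mulOp ((memLp_resolventWeight_mul hasTemperateGrowth_laplaceSymbol
          norm_laplaceSymbol_le).toLp _) (𝓕 (u t))
        + m t ^ 2 • mulOp (memLp_resolventWeight.toLp _) (𝓕 (u t)))) t := by
  have hF : ContinuousOn (fun t => 𝓕 (u t)) (Ici 0) :=
    continuous_fourier_L2.comp_continuousOn hu.contDiffOn.continuousOn
  have hw := hasTemperateGrowth_resolventWeight (n := n)
  have hs := hasTemperateGrowth_laplaceSymbol (n := n)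
  refine hasDerivAt_of_pairing (R := fun t => -(a t ^ 2 • mulOp ((memLp_resolventWeight_mul
    hasTemperateGrowth_laplaceSymbol norm_laplaceSymbol_le).toLp _) (𝓕 (u t))
        + m t ^ 2 • mulOp (memLp_resolventWeight.toLp _) (𝓕 (u t)))) ?_ (fun φ t ht => ?_) ht
  · exact (((ha.pow 2).smul ((mulOp _).continuous.comp_continuousOn hF)).add
      ((hm.pow 2).smul ((mulOp _).continuous.comp_continuousOn hF))).neg
  · have h1 : ∀ f : L2 n, (mulOp (memLp_resolventWeight.toLp _) (𝓕 f) :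
        𝓢'(EuclideanSpace ℝ (Fin n), ℂ)) φ = (f : 𝓢'(EuclideanSpace ℝ (Fin n), ℂ))
          (𝓕 (SchwartzMap.smulLeftCLM ℂ resolventWeight φ)) := fun f => by
      rw [toTemperedDistribution_mulOp hw, smulLeftCLM_apply_apply,
        ← Lp.fourier_toTemperedDistribution_eq, TemperedDistribution.fourier_apply]
    have h2 : ∀ f : L2 n, (mulOp ((memLp_resolventWeight_mul hasTemperateGrowth_laplaceSymbol
        norm_laplaceSymbol_le).toLp _) (𝓕 f) : 𝓢'(EuclideanSpace ℝ (Fin n), ℂ)) φ =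
        -(Δ (f : 𝓢'(EuclideanSpace ℝ (Fin n), ℂ)))
          (𝓕 (SchwartzMap.smulLeftCLM ℂ resolventWeight φ)) := fun f => by
      rw [toTemperedDistribution_mulOp (hw.mul hs), mul_comm,
        ← smulLeftCLM_smulLeftCLM_apply hs hw, smulLeftCLM_apply_apply,
        ← Lp.fourier_toTemperedDistribution_eq, ← TemperedDistribution.fourier_apply (Δ _),
        fourier_laplacian_eq_smulLeftCLM]
      simp [laplaceSymbol]
    -- The Fourier transform and the weight are moved onto the test function, where the
    -- distributional equation applies.
    have h3 := hu.equation (𝓕 (SchwartzMap.smulLeftCLM ℂ resolventWeight φ)) t ht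
    refine (h3.congr_of_eventuallyEq (.of_forall fun s => h1 _)).congr_deriv ?_
    rw [← pairing_apply, map_neg, map_add, pairing_real_smul, pairing_real_smul, pairing_apply,
      pairing_apply, h1, h2]
    simp
    ring

variable {S : Set (EuclideanSpace ℝ (Fin n))} {r δ : ℝ}

theorem memLp_indicator_of_bound (hS : MeasurableSet S) {g : EuclideanSpace ℝ (Fin n) → ℝ}
    (hg : Measurable g) {C : ℝ} (hC : ∀ x ∈ S, |g x| ≤ C) :
    MemLp (S.indicator fun x => (g x : ℂ)) ∞ volume := by
  refine memLp_top_of_bound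
    ((Complex.measurable_ofReal.comp hg).indicator hS).aestronglyMeasurable (max C 0)
    (.of_forall fun x => ?_)
  by_cases hx : x ∈ S
  · rw [indicator_of_mem hx, Complex.norm_real]
    exact (hC x hx).trans (le_max_left _ _)
  · rw [indicator_of_notMem hx, norm_zero]
    exact le_max_right _ _

/-- The restriction to the frequency set `S`. -/
def cutoff (hS : MeasurableSet S) : L2 n →L[ℂ] L2 n :=
  mulOp ((memLp_indicator_of_bound hS (g := fun _ => 1) (C := 1) measurable_const
    (by simp)).toLp _)

theorem coeFn_cutoff (hS : MeasurableSet S) (f : L2 n) :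
    cutoff hS f =ᵐ[volume] S.indicator f := by
  filter_upwards [coeFn_mulOp_toLp (memLp_indicator_of_bound hS (g := fun _ => 1) (C := 1)
    measurable_const (by simp)) f] with x hx
  rw [cutoff, hx]
  by_cases h : x ∈ S <;> simp [h]

theorem integrable_norm_sq_L2 (f : L2 n) : Integrable (fun x => ‖f x‖ ^ 2) volume :=
  (Lp.memLp f).norm.integrable_sq

theorem norm_sq_eq_integral_L2 (f : L2 n) : ‖f‖ ^ 2 = ∫ x, ‖f x‖ ^ 2 := by
  have h := inner_self_eq_norm_sq_to_K (𝕜 := ℂ) f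
  rw [L2.inner_def] at h
  simp_rw [inner_self_eq_norm_sq_to_K] at h
  have h2 : ∫ x, ((‖f x‖ : ℂ)) ^ 2 = ((∫ x, ‖f x‖ ^ 2 : ℝ) : ℂ) := by
    rw [← integral_complex_ofReal]; simp
  have h3 : ((∫ x, ‖f x‖ ^ 2 : ℝ) : ℂ) = ((‖f‖ ^ 2 : ℝ) : ℂ) := by
    rw [← h2]; simpa using h
  exact (Complex.ofReal_injective h3).symm

theorem norm_cutoff_sq (hS : MeasurableSet S) (f : L2 n) :
    ‖cutoff hS f‖ ^ 2 = ∫ x in S, ‖f x‖ ^ 2 := by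
  rw [norm_sq_eq_integral_L2, ← integral_indicator hS]
  refine integral_congr_ae ?_
  filter_upwards [coeFn_cutoff hS f] with x hx
  rw [hx]
  by_cases h : x ∈ S <;> simp [h]

/-- On a frequency band the equation is a perturbed oscillator with scalar frequency. -/
theorem IsEnergySolution.hasDerivAt_cutoff (ha : ContinuousOn a (Ici 0))
    (hm : ContinuousOn m (Ici 0)) (hu : IsEnergySolution a m u₀ u₁ u) (hS : MeasurableSet S)
    (hSr : ∀ x ∈ S, r ≤ laplaceSymbol x ∧ laplaceSymbol x ≤ r + δ) :
    ∃ f : ℝ → L2 n, (∀ t, ‖f t‖ ≤ a t ^ 2 * δ * ‖cutoff hS (𝓕 (u t))‖) ∧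
      ∀ t, 0 < t → HasDerivAt (fun s => cutoff hS (𝓕 (timeDeriv u s)))
        (-((r * (a t * a t) + m t * m t) • cutoff hS (𝓕 (u t))) - f t) t := by
  -- On `S` the symbol differs from `r` by at most `δ`; this difference produces the perturbation
  -- `f`.
  have hdev := memLp_indicator_of_bound hS (g := fun x => laplaceSymbol x - r) (C := δ)
    (measurable_laplaceSymbol.sub_const r) (fun x hx => by
      rw [abs_of_nonneg (by linarith [(hSr x hx).1])]; linarith [(hSr x hx).2])
  -- Frequencies in `S` are bounded, so the inverse of the weight is a bounded multiplier there and
  -- the weight can be removed.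
  have hlift := memLp_indicator_of_bound hS (g := fun x => 1 + ‖x‖ ^ 2) (C := 1 + (r + δ))
    (by fun_prop) (fun x hx => by
      have h1 := (hSr x hx).2
      have h2 : ‖x‖ ^ 2 ≤ laplaceSymbol x := by
        have : (1 : ℝ) ≤ 4 * Real.pi ^ 2 := by nlinarith [Real.pi_gt_three]
        unfold laplaceSymbol
        nlinarith [sq_nonneg ‖x‖]
      rw [abs_of_nonneg (by positivity)]
      linarith)
  have hw1 : ∀ x : EuclideanSpace ℝ (Fin n), ((1 + ‖x‖ ^ 2 : ℝ) : ℂ) * resolventWeight x = 1 :=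
    fun x => by
      rw [resolventWeight_eq, ← Complex.ofReal_mul, mul_inv_cancel₀ (by positivity),
        Complex.ofReal_one]
  have hQ1 : ∀ f : L2 n, mulOp (hlift.toLp _) (mulOp (memLp_resolventWeight.toLp _) f) =
      cutoff hS f := fun f => by
    apply Lp.ext
    filter_upwards [coeFn_mulOp_toLp hlift (mulOp (memLp_resolventWeight.toLp _) f),
      coeFn_mulOp_toLp memLp_resolventWeight f, coeFn_cutoff hS f] with x h1 h2 h3
    rw [h1, h2, h3]
    by_cases h : x ∈ S
    · rw [indicator_of_mem h, indicator_of_mem h, ← mul_assoc, hw1, one_mul]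
    · simp [h]
  have hQ2 : ∀ f : L2 n, mulOp (hlift.toLp _) (mulOp ((memLp_resolventWeight_mul
      hasTemperateGrowth_laplaceSymbol norm_laplaceSymbol_le).toLp _) f) =
      r • cutoff hS f + mulOp (hdev.toLp _) f := fun f => by
    apply Lp.ext
    filter_upwards [coeFn_mulOp_toLp hlift (mulOp ((memLp_resolventWeight_mul
      hasTemperateGrowth_laplaceSymbol norm_laplaceSymbol_le).toLp _) f),
      coeFn_mulOp_toLp (memLp_resolventWeight_mul
      hasTemperateGrowth_laplaceSymbol norm_laplaceSymbol_le) f, coeFn_cutoff hS f,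
      coeFn_mulOp_toLp hdev f, Lp.coeFn_add (r • cutoff hS f) (mulOp (hdev.toLp _) f),
      Lp.coeFn_smul r (cutoff hS f)] with x h1 h2 h3 h4 h5 h6
    rw [h1, h2, h5, Pi.add_apply, h6, Pi.smul_apply, h3, h4]
    by_cases h : x ∈ S
    · rw [indicator_of_mem h, indicator_of_mem h, indicator_of_mem h, Pi.mul_apply, ← mul_assoc,
        ← mul_assoc, hw1, Complex.real_smul]
      push_cast
      ring
    · simp [h]
  refine ⟨fun t => a t ^ 2 • mulOp (hdev.toLp _) (𝓕 (u t)), fun t => ?_, fun t ht => ?_⟩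
  · rw [norm_smul, Real.norm_of_nonneg (sq_nonneg _), mul_assoc]
    gcongr
    refine Lp.norm_le_mul_norm_of_ae_le_mul ?_
    filter_upwards [coeFn_mulOp_toLp hdev (𝓕 (u t)), coeFn_cutoff hS (𝓕 (u t))] with x h1 h2
    rw [h1, h2]
    by_cases h : x ∈ S
    · rw [indicator_of_mem h, indicator_of_mem h, norm_mul, Complex.norm_real,
        Real.norm_of_nonneg (by linarith [(hSr x h).1])]
      gcongr
      linarith [(hSr x h).2]
    · simp [h]
  · have h := ((mulOp (hlift.toLp _)).restrictScalars ℝ).hasFDerivAt.comp_hasDerivAt t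
      (hu.hasDerivAt_weighted ha hm ht)
    refine (h.congr_of_eventuallyEq (.of_forall fun s => (hQ1 _).symm)).congr_deriv ?_
    rw [map_neg, map_add, map_smul, map_smul]
    change -(a t ^ 2 • mulOp (hlift.toLp _) _ + m t ^ 2 • mulOp (hlift.toLp _) _) = _
    rw [hQ1, hQ2]
    module

/-- Plancherel's theorem for each weak partial derivative, with `∂_j` acting as `2πi ξ_j`. -/
theorem MemH1.sum_norm_sq_weakPartial {f : L2 n} (hf : MemH1 f) :
    Integrable (fun x => laplaceSymbol x * ‖(𝓕 f : L2 n) x‖ ^ 2) volume ∧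
      ∑ j, ‖weakPartial j f‖ ^ 2 = ∫ x, laplaceSymbol x * ‖(𝓕 f : L2 n) x‖ ^ 2 := by
  have hj : ∀ j : Fin n, (fun x => ‖(𝓕 (weakPartial j f) : L2 n) x‖ ^ 2) =ᵐ[volume]
      fun x => 4 * Real.pi ^ 2 * x j ^ 2 * ‖(𝓕 f : L2 n) x‖ ^ 2 := fun j => by
    filter_upwards [coeFn_fourier_of_isWeakPartial (isWeakPartial_weakPartial j hf)] with x hx
    rw [hx]
    simp only [norm_mul, Complex.norm_real, Complex.norm_I, mul_one, Complex.norm_ofNat,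
      Real.norm_eq_abs, mul_pow, sq_abs]
    norm_num
  have hsum : ∀ x : EuclideanSpace ℝ (Fin n), laplaceSymbol x * ‖(𝓕 f : L2 n) x‖ ^ 2 =
      ∑ j, 4 * Real.pi ^ 2 * x j ^ 2 * ‖(𝓕 f : L2 n) x‖ ^ 2 := fun x => by
    rw [laplaceSymbol, EuclideanSpace.real_norm_sq_eq, Finset.mul_sum, Finset.sum_mul]
  have hint : ∀ j : Fin n,
      Integrable (fun x => 4 * Real.pi ^ 2 * x j ^ 2 * ‖(𝓕 f : L2 n) x‖ ^ 2) volume :=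
    fun j => (integrable_norm_sq_L2 _).congr (hj j)
  simp_rw [hsum]
  refine ⟨integrable_finsetSum _ fun j _ => hint j, ?_⟩
  rw [integral_finsetSum _ fun j _ => hint j]
  refine Finset.sum_congr rfl fun j _ => ?_
  rw [← Lp.norm_fourier_eq, norm_sq_eq_integral_L2]
  exact integral_congr_ae (hj j)

/-- The bands `k δ ≤ 4π²|ξ|² < (k + 1) δ`. -/
def band (n : ℕ) (δ : ℝ) (k : ℕ) : Set (EuclideanSpace ℝ (Fin n)) :=
  (fun x => ⌊laplaceSymbol x / δ⌋₊) ⁻¹' {k}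

theorem measurableSet_band (δ : ℝ) (k : ℕ) : MeasurableSet (band n δ k) :=
  (Nat.measurable_floor.comp (measurable_laplaceSymbol.div_const δ)) (measurableSet_singleton k)

theorem le_laplaceSymbol_of_mem_band (hδ : 0 < δ) {k : ℕ} {x : EuclideanSpace ℝ (Fin n)}
    (hx : x ∈ band n δ k) : k * δ ≤ laplaceSymbol x ∧ laplaceSymbol x ≤ k * δ + δ := by
  have hx' : ⌊laplaceSymbol x / δ⌋₊ = k := hx
  have h1 := Nat.floor_le (div_nonneg (laplaceSymbol_nonneg x) hδ.le)
  have h2 := Nat.lt_floor_add_one (laplaceSymbol x / δ)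
  rw [hx', le_div_iff₀ hδ] at h1
  rw [hx', div_lt_iff₀ hδ] at h2
  exact ⟨h1, by linarith⟩

theorem hasSum_integral_band (δ : ℝ) {f : EuclideanSpace ℝ (Fin n) → ℝ}
    (hf : Integrable f volume) :
    HasSum (fun k => ∫ x in band n δ k, f x) (∫ x, f x) := by
  have h := hasSum_integral_iUnion (f := f) (μ := volume) (s := band n δ)
    (measurableSet_band δ) (pairwise_disjoint_fiber _) hf.integrableOn
  have hU : ⋃ k, band n δ k = univ := by
    ext x; simp [band]
  rwa [hU, setIntegral_univ] at h

end Band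

/-! ### Band estimates and their summation -/

section EnergyEstimate

open FourierTransform

variable {n : ℕ} {a m μ : ℝ → ℝ} {u₀ u₁ : L2 n} {u : ℝ → L2 n}

/-- Twice the energy density on the Fourier side, with weights `α` and `β` on `|∇u|²`, `|u|²`. -/
def energyDensity (α β : ℝ) (f g : L2 n) (x : EuclideanSpace ℝ (Fin n)) : ℝ :=
  ‖(𝓕 g : L2 n) x‖ ^ 2 + α * (laplaceSymbol x * ‖(𝓕 f : L2 n) x‖ ^ 2) +
    β * ‖(𝓕 f : L2 n) x‖ ^ 2

theorem integrable_energyDensity (α β : ℝ) {f : L2 n} (hf : MemH1 f) (g : L2 n) :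
    Integrable (energyDensity α β f g) volume :=
  ((integrable_norm_sq_L2 _).add (hf.sum_norm_sq_weakPartial.1.const_mul α)).add
    ((integrable_norm_sq_L2 _).const_mul β)

theorem integral_energyDensity (α β : ℝ) {f : L2 n} (hf : MemH1 f) (g : L2 n) :
    ∫ x, energyDensity α β f g x =
      ‖g‖ ^ 2 + α * ∑ j, ‖weakPartial j f‖ ^ 2 + β * ‖f‖ ^ 2 := by
  obtain ⟨hi, hs⟩ := hf.sum_norm_sq_weakPartial
  have h12 : Integrable (fun x => ‖(𝓕 g : L2 n) x‖ ^ 2 +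
      α * (laplaceSymbol x * ‖(𝓕 f : L2 n) x‖ ^ 2)) volume :=
    (integrable_norm_sq_L2 _).add (hi.const_mul α)
  unfold energyDensity
  rw [integral_add h12
    ((integrable_norm_sq_L2 _).const_mul β), integral_add (integrable_norm_sq_L2 _)
    (hi.const_mul α), integral_const_mul, integral_const_mul, ← norm_sq_eq_integral_L2,
    ← norm_sq_eq_integral_L2, hs, Lp.norm_fourier_eq, Lp.norm_fourier_eq]

variable {S : Set (EuclideanSpace ℝ (Fin n))} {r δ : ℝ}

theorem setIntegral_energyDensity (hS : MeasurableSet S) (α β : ℝ) {f : L2 n} (hf : MemH1 f)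
    (g : L2 n) : ∫ x in S, energyDensity α β f g x = ‖cutoff hS (𝓕 g)‖ ^ 2 +
      α * (∫ x in S, laplaceSymbol x * ‖(𝓕 f : L2 n) x‖ ^ 2) + β * ‖cutoff hS (𝓕 f)‖ ^ 2 := by
  have hi := hf.sum_norm_sq_weakPartial.1.integrableOn (s := S)
  have h1 := fun h : L2 n => (integrable_norm_sq_L2 h).integrableOn (s := S)
  have h12 : IntegrableOn (fun x => ‖(𝓕 g : L2 n) x‖ ^ 2 +
      α * (laplaceSymbol x * ‖(𝓕 f : L2 n) x‖ ^ 2)) S volume :=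
    (h1 _).add (hi.const_mul α)
  unfold energyDensity
  rw [integral_add h12 ((h1 _).const_mul β),
    integral_add (h1 _) (hi.const_mul α), integral_const_mul, integral_const_mul,
    norm_cutoff_sq, norm_cutoff_sq]

theorem setIntegral_laplaceSymbol_bounds (hS : MeasurableSet S) {f : L2 n} (hf : MemH1 f)
    (hSr : ∀ x ∈ S, r ≤ laplaceSymbol x ∧ laplaceSymbol x ≤ r + δ) :
    r * ‖cutoff hS (𝓕 f)‖ ^ 2 ≤ ∫ x in S, laplaceSymbol x * ‖(𝓕 f : L2 n) x‖ ^ 2 ∧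
    ∫ x in S, laplaceSymbol x * ‖(𝓕 f : L2 n) x‖ ^ 2 ≤ (r + δ) * ‖cutoff hS (𝓕 f)‖ ^ 2 := by
  have hi := hf.sum_norm_sq_weakPartial.1.integrableOn (s := S)
  have h1 := (integrable_norm_sq_L2 (𝓕 f : L2 n)).integrableOn (s := S)
  rw [norm_cutoff_sq, ← integral_const_mul, ← integral_const_mul]
  exact ⟨setIntegral_mono_on (h1.const_mul r) hi hS fun x hx =>
      mul_le_mul_of_nonneg_right (hSr x hx).1 (sq_nonneg _),
    setIntegral_mono_on hi (h1.const_mul (r + δ)) hS fun x hx =>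
      mul_le_mul_of_nonneg_right (hSr x hx).2 (sq_nonneg _)⟩

/-- The bound on a single frequency band, given the frozen-frequency oscillator estimate. -/
theorem setIntegral_energyDensity_le {B aT mT : ℝ} (hS : MeasurableSet S) (hr : 0 ≤ r)
    (hB : 0 ≤ B) (haT : 0 < aT) (hmT : 0 < mT) (hδ : aT ^ 2 * δ ≤ mT ^ 2)
    (hSr : ∀ x ∈ S, r ≤ laplaceSymbol x ∧ laplaceSymbol x ≤ r + δ)
    {f g f₀ g₀ : L2 n} (hf : MemH1 f) (hf₀ : MemH1 f₀)
    (h : ‖cutoff hS (𝓕 g)‖ ^ 2 + (r * (aT * aT) + mT * mT) * ‖cutoff hS (𝓕 f)‖ ^ 2 ≤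
      B * (√(r * (aT * aT) + mT * mT) / √(r + 1) *
        (‖cutoff hS (𝓕 g₀)‖ ^ 2 + (r + 1) * ‖cutoff hS (𝓕 f₀)‖ ^ 2))) :
    ∫ x in S, energyDensity (aT ^ 2) (mT * max aT mT) f g x ≤
      2 * B * max aT mT * ∫ x in S, energyDensity 1 1 f₀ g₀ x := by
  rw [setIntegral_energyDensity hS _ _ hf, setIntegral_energyDensity hS _ _ hf₀]
  have hi := (setIntegral_laplaceSymbol_bounds hS hf hSr).2
  have hi₀ := (setIntegral_laplaceSymbol_bounds hS hf₀ hSr).1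
  generalize ∫ x in S, laplaceSymbol x * ‖(𝓕 f : L2 n) x‖ ^ 2 = I at *
  generalize ∫ x in S, laplaceSymbol x * ‖(𝓕 f₀ : L2 n) x‖ ^ 2 = I₀ at *
  set G := ‖cutoff hS (𝓕 g)‖ ^ 2
  set F := ‖cutoff hS (𝓕 f)‖ ^ 2
  set G₀ := ‖cutoff hS (𝓕 g₀)‖ ^ 2
  set F₀ := ‖cutoff hS (𝓕 f₀)‖ ^ 2
  have hG : 0 ≤ G := sq_nonneg _
  have hF : 0 ≤ F := sq_nonneg _
  have hG₀ : 0 ≤ G₀ := sq_nonneg _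
  have hF₀ : 0 ≤ F₀ := sq_nonneg _
  set γ := max aT mT
  have hγ : 0 < γ := haT.trans_le (le_max_left _ _)
  set Λ := r * (aT * aT) + mT * mT with hΛ
  have hΛ0 : 0 < Λ := by positivity
  have hs : 0 < √Λ := Real.sqrt_pos.2 hΛ0
  have hs₀ : 1 ≤ √(r + 1) := Real.one_le_sqrt.2 (by linarith)
  have hms : mT ≤ √Λ := Real.le_sqrt_of_sq_le (by rw [hΛ]; nlinarith [mul_nonneg hr (sq_nonneg aT)])
  -- Both `a²` and `m²` are at most `γ²`, and `r + 1` is the value of `Λ` at time `0`.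
  have hsγ : √Λ ≤ γ * √(r + 1) := by
    rw [← Real.sqrt_sq hγ.le, ← Real.sqrt_mul (sq_nonneg γ)]
    refine Real.sqrt_le_sqrt ?_
    have h1 : aT * aT ≤ γ ^ 2 := by
      rw [← sq]; exact pow_le_pow_left₀ haT.le (le_max_left _ _) 2
    have h2 : mT * mT ≤ γ ^ 2 := by
      rw [← sq]; exact pow_le_pow_left₀ hmT.le (le_max_right _ _) 2
    rw [hΛ]
    nlinarith [mul_le_mul_of_nonneg_left h1 hr]
  set X := G₀ + (r + 1) * F₀ with hX
  have hX0 : 0 ≤ X := by positivity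
  have hXI : X ≤ G₀ + 1 * I₀ + 1 * F₀ := by rw [hX]; linarith
  have hq : √Λ / √(r + 1) ≤ γ := (div_le_iff₀ (by linarith)).2 hsγ
  have hA : G + Λ * F ≤ B * γ * X := h.trans (by rw [mul_assoc]; gcongr)
  -- The gain for the mass term: one factor `√Λ` cancels from both sides, and `√(r + 1) ≥ 1` is
  -- dropped.
  have hmF : mT * F ≤ B * X := by
    have h1 : √Λ * (√Λ * F) ≤ √Λ * (B * X) := by
      rw [← mul_assoc, Real.mul_self_sqrt hΛ0.le]
      calc Λ * F ≤ G + Λ * F := by linarith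
        _ ≤ B * (√Λ / √(r + 1) * X) := h
        _ ≤ B * (√Λ * X) := by gcongr; exact div_le_self hs.le hs₀
        _ = √Λ * (B * X) := by ring
    have h2 := le_of_mul_le_mul_left h1 hs
    exact (mul_le_mul_of_nonneg_right hms hF).trans h2
  -- Replacing the true symbol by `r` costs `aT² δ`, which the mass part `mT²` of `Λ` absorbs.
  have hI : aT ^ 2 * I ≤ Λ * F := by
    calc aT ^ 2 * I ≤ aT ^ 2 * ((r + δ) * F) := by gcongr
      _ = (r * (aT * aT) + aT ^ 2 * δ) * F := by ring
      _ ≤ Λ * F := by rw [hΛ, ← sq mT]; gcongr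
  calc G + aT ^ 2 * I + mT * γ * F ≤ B * γ * X + γ * (B * X) := by
        have := mul_le_mul_of_nonneg_left hmF hγ.le
        linarith
    _ = 2 * B * γ * X := by ring
    _ ≤ _ := by gcongr

/-- Compactness of `[0, T]`. The first bound absorbs the frozen symbol in the gradient term; the
second keeps the accumulated perturbation over `[0, T]` below `1`. -/
theorem SpeedHyp.exists_band_width (ha : SpeedHyp a) (hm : MassHyp a m μ) {T : ℝ} (hT : 0 ≤ T) :
    ∃ δ, 0 < δ ∧ ∀ t ∈ Icc 0 T, a t ^ 2 * δ ≤ m t ^ 2 ∧ a t ^ 2 * δ ≤ (T + 1)⁻¹ * m t := by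
  have hc : ContinuousOn (fun t => min (m t ^ 2) ((T + 1)⁻¹ * m t) / a t ^ 2) (Icc 0 T) := by
    have h1 := ha.contDiffOn.continuousOn.mono (Icc_subset_Ici_self : Icc 0 T ⊆ Ici 0)
    have h2 := hm.contDiffOn.continuousOn.mono (Icc_subset_Ici_self : Icc 0 T ⊆ Ici 0)
    exact ContinuousOn.div (ContinuousOn.inf (h2.pow 2) (continuousOn_const.mul h2)) (h1.pow 2)
      fun t ht => pow_ne_zero 2 (ha.pos t ht.1).ne'
  obtain ⟨s, hs, hmin⟩ := isCompact_Icc.exists_isMinOn (nonempty_Icc.2 hT) hc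
  have hms := hm.pos s hs.1
  have has := ha.pos s hs.1
  refine ⟨_, (by positivity : 0 < min (m s ^ 2) ((T + 1)⁻¹ * m s) / a s ^ 2), fun t ht => ?_⟩
  have hat := ha.pos t ht.1
  have h := hmin ht
  simp only [mem_ofPred_eq] at h
  rw [le_div_iff₀ (by positivity), mul_comm] at h
  exact ⟨h.trans (min_le_left _ _), h.trans (min_le_right _ _)⟩

/-- A primitive of `η² / m` is bounded on `[0, ∞)`. -/
theorem exists_primitive_eta_sq_div (ha : SpeedHyp a) (hm : MassHyp a m μ)
    (hint : IntegrableOn (fun t => eta a t / μ t) (Ici 0)) :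
    ∃ (N : ℝ → ℝ) (M : ℝ), (∀ t, 0 ≤ t → HasDerivAt N (eta a t ^ 2 / m t) t) ∧
      ∀ t, 0 ≤ t → N t - N 0 ≤ M := by
  have hη := ha.contDiffOn_eta.continuousOn
  obtain ⟨N, hN, hN'⟩ := exists_primitive_of_continuousOn_Ici
    ((hη.pow 2).div hm.contDiffOn.continuousOn fun t ht => (hm.pos t ht).ne')
  refine ⟨N, ∫ t in Ici 0, eta a t / μ t, hN', fun t ht => ?_⟩
  rw [hN t ht, hN 0 le_rfl, intervalIntegral.integral_same, sub_zero,
    intervalIntegral.integral_of_le ht]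
  have hsub : Ioc 0 t ⊆ Ici (0 : ℝ) := fun s hs => hs.1.le
  -- Since `m = μη`, the Liouville–Green error `η²/m` is exactly the integrable function `η/μ`.
  calc ∫ s in Ioc 0 t, (eta a ^ 2 / m) s = ∫ s in Ioc 0 t, eta a s / μ s := by
        refine setIntegral_congr_fun measurableSet_Ioc fun s hs => ?_
        have h1 := ha.eta_pos hs.1.le
        have h2 := hm.mu_pos ha hs.1.le
        simp only [Pi.div_apply, Pi.pow_apply, hm.form s hs.1.le]
        field_simp
    _ ≤ ∫ s in Ici 0, eta a s / μ s := by
        refine setIntegral_mono_set hint ?_ hsub.eventuallyLE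
        filter_upwards [ae_restrict_mem measurableSet_Ici] with s hs
        exact (div_pos (ha.eta_pos hs) (hm.mu_pos ha hs)).le

theorem IsEnergySolution.continuousOn_cutoff (hu : IsEnergySolution a m u₀ u₁ u)
    (hS : MeasurableSet S) :
    ContinuousOn (fun t => cutoff hS (𝓕 (u t))) (Ici 0) ∧
      ContinuousOn (fun t => cutoff hS (𝓕 (timeDeriv u t))) (Ici 0) ∧
      ∀ t, 0 < t → HasDerivAt (fun s => cutoff hS (𝓕 (u s))) (cutoff hS (𝓕 (timeDeriv u t))) t :=
  ⟨((cutoff hS).continuous.comp continuous_fourier_L2).comp_continuousOn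
      hu.contDiffOn.continuousOn,
    ((cutoff hS).continuous.comp continuous_fourier_L2).comp_continuousOn
      hu.continuousOn_timeDeriv,
    fun t ht => ((cutoff hS).restrictScalars ℝ).hasFDerivAt.comp_hasDerivAt t
      (hasDerivAt_fourier ((hu.hasDerivWithinAt ht.le).hasDerivAt (Ici_mem_nhds ht)))⟩

theorem energy_eq_integral {t : ℝ} (hu : MemH1 (u t)) :
    energy a m u t =
      1 / 2 * ∫ x, energyDensity (a t ^ 2) (m t * gam a m t) (u t) (timeDeriv u t) x := by
  rw [integral_energyDensity _ _ hu, energy]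

theorem exists_energy_le (ha : SpeedHyp a) (hm : MassHyp a m μ)
    (heff : Tendsto μ atTop atTop) (hint : IntegrableOn (fun t => eta a t / μ t) (Ici 0)) :
    ∃ C : ℝ, 0 < C ∧ ∀ (u₀ u₁ : L2 n) (u : ℝ → L2 n), IsEnergySolution a m u₀ u₁ u →
      ∀ t, 0 ≤ t → energy a m u t ≤ C * gam a m t * energy a m u 0 := by
  obtain ⟨a₁, a₂, Ca, hCa, hab⟩ := ha.symbolBound
  obtain ⟨m₁, m₂, Cm, hCm, hmb⟩ := hm.symbolBound ha
  obtain ⟨K, hηm⟩ := exists_eta_le_mass ha hm heff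
  obtain ⟨N, M, hN', hNM⟩ := exists_primitive_eta_sq_div ha hm hint
  have hη : ∀ t, 0 ≤ t → 0 ≤ eta a t := fun t ht => (ha.eta_pos ht).le
  have hap : ∀ t, 0 ≤ t → 0 ≤ a t := fun t ht => (ha.pos t ht).le
  have hmp : ∀ t, 0 ≤ t → 0 ≤ m t := fun t ht => (hm.pos t ht).le
  set Ca' := Ca + Ca + 2 * Ca * Ca
  set Cm' := Cm + Cm + 2 * Cm * Cm
  set C := max Ca' Cm'
  have hC : 0 ≤ C := (by positivity : 0 ≤ Ca').trans (le_max_left _ _)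
  have haa := (hab.mul hCa hCa hab hη hap hap).mono hη
    (fun t ht => mul_nonneg (hap t ht) (hap t ht)) (le_max_left Ca' Cm')
  have hmm := (hmb.mul hCm hCm hmb hη hmp hmp).mono hη
    (fun t ht => mul_nonneg (hmp t ht) (hmp t ht)) (le_max_right Ca' Cm')
  set B := (2 + 2 * (C * K) ^ 2) ^ 2 * Real.exp ((C + C ^ 2) * M + 1)
  have hB : 0 < B := by positivity
  refine ⟨2 * B, by positivity, fun u₀ u₁ u hu T hT => ?_⟩
  -- Only the decomposition depends on `T`; `B` has been fixed before.
  obtain ⟨δ, hδ, hδT⟩ := ha.exists_band_width hm hT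
  have hac := ha.contDiffOn.continuousOn
  have hmc := hm.contDiffOn.continuousOn
  have hγ0 : gam a m 0 = 1 := by simp [gam, ha.init, hm.init]
  rw [energy_eq_integral (hu.memH1 T hT), energy_eq_integral (hu.memH1 0 le_rfl), hγ0,
    ha.init, hm.init, one_pow, one_mul, mul_left_comm]
  refine mul_le_mul_of_nonneg_left ?_ (by norm_num)
  refine hasSum_le (fun k => ?_)
    (hasSum_integral_band δ (integrable_energyDensity _ _ (hu.memH1 T hT) _))
    ((hasSum_integral_band δ (integrable_energyDensity _ _ (hu.memH1 0 le_rfl) _)).mul_left _)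
  have hS := measurableSet_band (n := n) δ k
  have hr : 0 ≤ k * δ := by positivity
  have hSr : ∀ x ∈ band n δ k, k * δ ≤ laplaceSymbol x ∧ laplaceSymbol x ≤ k * δ + δ :=
    fun x hx => le_laplaceSymbol_of_mem_band hδ hx
  obtain ⟨f, hf, hd₁⟩ := hu.hasDerivAt_cutoff hac hmc hS hSr
  obtain ⟨hwc, hw₁c, hd⟩ := hu.continuousOn_cutoff hS
  have hTε : (T + 1)⁻¹ * T ≤ 1 := by
    rw [inv_mul_le_iff₀ (by positivity)]; linarith
  -- The frozen squared frequency is `Λ = kδ a² + m²`, with a symbol constant `C` independent of `k`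
  -- and `δ`.
  have hosc := oscillator_energy_le (ε := (T + 1)⁻¹) hC hT (by positivity) hTε
    ((haa.const_mul hr).add hmm) hη hm.pos (fun t ht => by
      have := mul_nonneg hr (mul_nonneg (hap t ht) (hap t ht))
      linarith [sq (m t)]) hηm (fun t ht => (hN' t ht.1).continuousAt.continuousWithinAt)
    (fun t ht => hN' t ht.le) (hNM T hT) hd hd₁ hwc hw₁c
    (fun t ht => (hf t).trans (mul_le_mul_of_nonneg_right
      (hδT t ⟨ht.1.le, ht.2.le⟩).2 (norm_nonneg _)))
  simp only [ha.init, hm.init, mul_one] at hosc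
  exact setIntegral_energyDensity_le hS hr hB.le (ha.pos T hT) (hm.pos T hT)
    (hδT T (right_mem_Icc.2 hT)).1 hSr (hu.memH1 T hT) (hu.memH1 0 le_rfl) hosc

theorem half_mul_norm_sq_le_energy (t : ℝ) :
    1 / 2 * (m t * gam a m t * ‖u t‖ ^ 2) ≤ energy a m u t := by
  have : 0 ≤ a t ^ 2 * ∑ j, ‖weakPartial j (u t)‖ ^ 2 := by positivity
  unfold energy
  nlinarith [sq_nonneg ‖timeDeriv u t‖]

end EnergyEstimate

end EffectivePotential

end

theorem theorem2p1 (n : ℕ) (a m μ : ℝ → ℝ)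
    (ha : SpeedHyp a) (hm : MassHyp a m μ)
    (heff : Tendsto μ atTop atTop)
    (hint : IntegrableOn (fun t => eta a t / μ t) (Ici 0)) :
    ∃ C : ℝ, 0 < C ∧ ∀ (u₀ u₁ : L2 n), MemH1 u₀ →
      ∀ u : ℝ → L2 n, IsEnergySolution a m u₀ u₁ u →
        (∀ t, 0 ≤ t → energy a m u t ≤ C * gam a m t * energy a m u 0) ∧
        (∀ t, 0 ≤ t → ‖u t‖ ^ 2 ≤ C / m t * energy a m u 0) := by
  obtain ⟨C, hC, h⟩ := exists_energy_le (n := n) ha hm heff hint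
  -- The factor `2` compensates the `½` in front of `m γ ‖u‖²` in the energy; `γ` then cancels.
  refine ⟨2 * C, by positivity, fun u₀ u₁ _ u hu => ?_⟩
  have hE : 0 ≤ energy a m u 0 := by
    have : 0 ≤ gam a m 0 := by simp [gam, ha.init]
    have h1 : 0 ≤ m 0 * gam a m 0 * ‖u 0‖ ^ 2 := by rw [hm.init]; positivity
    linarith [half_mul_norm_sq_le_energy (a := a) (m := m) (u := u) 0]
  refine ⟨fun t ht => (h u₀ u₁ u hu t ht).trans ?_, fun t ht => ?_⟩
  · have : 0 < gam a m t := (ha.pos t ht).trans_le (le_max_left _ _)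
    gcongr
    linarith
  · have hγ : 0 < gam a m t := (ha.pos t ht).trans_le (le_max_left _ _)
    have hmt := hm.pos t ht
    have h1 := (half_mul_norm_sq_le_energy (a := a) (m := m) (u := u) t).trans (h u₀ u₁ u hu t ht)
    rw [div_mul_eq_mul_div, le_div_iff₀ hmt]
    refine le_of_mul_le_mul_left ?_ hγ
    linarith
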